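/- **Theorem (closed-form Floquet factorization).** Let $T>0$, $\omega=2\pi/T$, and let $A:\mathbb R\to\mathbb C^{n\times n}$ be $T$-periodic with $A\in L^2([0,T],\mathbb C^{n\times n})$. "Absolutely continuous" means absolutely continuous on every compact interval, and solutions of differential equations on $\mathbb R$ are in the Carathéodory sense (absolutely continuous, equation a.e.). Then $\dot x=A(t)x$ has a unique state transition matrix $\Phi(t,0)$ with $\Phi(0,0)=Id_n$. The matrix $\Phi(T,0)$ has a Jordan basis. Let $P=[\phi_1,\dots,\phi_n]$ be any Jordan basis of it, i.e. $P$ is invertible and $P^{-1}\Phi(T,0)P$ is the upper bidiagonal Jordan form with diagonal $\mu_1,\dots,\mu_n$ and with $(i,i+1)$ entry $1$ inside a Jordan block and $0$ otherwise. All $\mu_i$ are nonzero. Let $\lambda_i$ be the principal value of $\frac1T\log\mu_i$, and let $\Lambda$ be the Jordan form with $\Lambda(i,i)=\lambda_i$, $\Lambda(i,i+1)=\frac1{T\mu_i}$ inside a Jordan block, and zeros elsewhere. Call an invertible matrix $\Psi=[\psi_1,\dots,\psi_n]$ *normalized* if $\Phi(T,0)\Psi=\Psi e^{T\Lambda}$,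 i.e. if along each block with eigenvalue $\mu$ and columns $\psi_p,\psi_{p+1},\dots$ one has $\Phi(T,0)\psi_j=\sum_{k=0}^{j-p}\frac{\mu^{1-k}}{k!}\psi_{j-k}$. 1. There is a normalized $\Psi$ such that each $\psi_j-\phi_j$ is a linear combination of the $\phi_i$ with $i<j$ in the same Jordan block as $\phi_j$, and such that $\psi_j=\phi_j$ whenever $\phi_j$ is the first or the second vector of its block. In particular $\Psi=P$ if $\Phi(T,0)$ has no Jordan block of size $\ge 3$, e.g. if it is diagonalizable. 2. For every normalized $\Psi$, the initial value problems $$\dot v_j=(A(t)-\lambda_j Id_n)v_j-s_j v_{j-1},\qquad v_j(0)=\psi_j,\qquad j=1,\dots,n,$$ where $s_j=\frac{1}{T\mu_{j-1}}$ if $j-1$ and $j$ belong to the same Jordan block and $s_j=0$ otherwise, have a unique solution $(v_1,\dots,v_n)$. Each $v_j$ is $T$-periodic, and $W(t):=[v_1(t),\dots,v_n(t)]$ satisfies: * $W(t)$ is invertible for every $t$; $W$ and $W^{-1}$ are $T$-periodic and absolutely continuous; and $W,\Lambda$ give a Floquet factorization: $\Phi(t,0)=W(t)e^{t\Lambda}W(0)^{-1}$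 for all $t$; * $\dot W=AW-W\Lambda$ and $\frac{d}{dt}W^{-1}=-W^{-1}A+\Lambda W^{-1}$ almost everywhere; * for a $T$-periodic matrix function $B$ let $\mathcal T(B)$ be the $n\times n$ block matrix whose block $(i,j)$ is the Toeplitz matrix $(b_{ij,k-l})_{k,l\in\mathbb Z}$, with $b_{ij,k}=\frac1T\int_0^T b_{ij}(\tau)e^{-\mathrm i\omega k\tau}d\tau$. Put $\mathcal A=\mathcal T(A)$, $\mathcal N=Id_n\otimes\mathrm{diag}(\mathrm i\omega k,\ k\in\mathbb Z)$, and let $\mathcal I$ be the identity indexed by $\mathbb Z$. Then $\mathcal W:=\mathcal T(W)$ is a bounded operator on $\ell^2(\mathbb C^n)$ with bounded inverse, and $$\mathcal W^{-1}(\mathcal A-\mathcal N)\mathcal W=\Lambda\otimes\mathcal I-\mathcal N$$ as unbounded operators on $\ell^2(\mathbb C^n)$ (equality of domains included), where an infinite matrix acts on its maximal domain, i.e. on all $x\in\ell^2$ whose image sequence is well defined and in $\ell^2$; * a function $x:\mathbb R\to\mathbb C^n$ is a solution of $\dot x=A(t)x$ if and only if $z=W^{-1}x$ is a solution of $\dot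 z=\Lambda z$. -/

import Mathlib

open MeasureTheory
open scoped Kronecker Matrix

noncomputable section

namespace Floquet

/-! ### Carathéodory solutions -/

/-- Local absolute continuity: absolute continuity on every compact interval. -/
def LocAbsCont (f : ℝ → ℂ) : Prop :=
  ∀ a b : ℝ, AbsolutelyContinuousOnInterval f a b

/-- `x` is a solution on `ℝ`, in the Carathéodory sense, of `ẋ = A(t) x`. -/
def IsSolution {n : ℕ} (A : ℝ → Matrix (Fin n) (Fin n) ℂ) (x : ℝ → Fin n → ℂ) : Prop :=
  (∀ i, LocAbsCont (fun t => x t i)) ∧ ∀ᵐ t : ℝ, HasDerivAt x (A t *ᵥ x t) t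

/-- `Φ = Φ(·,0)` is the state transition (Wronski) matrix of `ẋ = A(t) x`: its `j`-th column is the
solution that starts at the `j`-th vector of the canonical basis. -/
def IsTransitionMatrix {n : ℕ} (A Φ : ℝ → Matrix (Fin n) (Fin n) ℂ) : Prop :=
  Φ 0 = 1 ∧ ∀ j, IsSolution A (fun t i => Φ t i j)

/-! ### Jordan forms

A Jordan form of size `n` is coded by its diagonal `μ` and by `s : Fin n → Bool`, where `s j = true`
says that column `j` continues the Jordan block of column `j - 1` (the superdiagonal entry of
column `j` is nonzero). -/

/-- Column `j` continues the Jordan block of its predecessor `i`. -/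
def Link {n : ℕ} (s : Fin n → Bool) (i j : Fin n) : Prop :=
  (i : ℕ) + 1 = j ∧ s j = true

instance {n : ℕ} (s : Fin n → Bool) (i j : Fin n) : Decidable (Link s i j) :=
  inferInstanceAs (Decidable (_ ∧ _))

/-- Upper bidiagonal matrix: diagonal `d`, entry `c i` at the linked positions `(i, i+1)`. -/
def jordanMatrix {n : ℕ} (d c : Fin n → ℂ) (s : Fin n → Bool) : Matrix (Fin n) (Fin n) ℂ :=
  Matrix.of fun i j => if i = j then d i else if Link s i j then c i else 0

/-- `P⁻¹ M P` is the Jordan normal form with eigenvalues `μ` and block structure `s`, so that the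
columns of `P` are the generalized eigenvectors `φ₁, …, φₙ` of `M`. -/
def IsJordanBasis {n : ℕ} (M : Matrix (Fin n) (Fin n) ℂ) (μ : Fin n → ℂ) (s : Fin n → Bool)
    (P : Matrix (Fin n) (Fin n) ℂ) : Prop :=
  (∀ j, s j = true → ∃ i, Link s i j ∧ μ i = μ j) ∧
    IsUnit P.det ∧ P⁻¹ * M * P = jordanMatrix μ (fun _ => 1) s

/-- `i ≤ j` belong to the same Jordan block. -/
def SameBlock {n : ℕ} (s : Fin n → Bool) (i j : Fin n) : Prop :=
  i ≤ j ∧ ∀ k, i < k → k ≤ j → s k = true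

/-- The principal value of `(1/T) log μᵢ`. -/
def floquetExponent {n : ℕ} (T : ℝ) (μ : Fin n → ℂ) (i : Fin n) : ℂ :=
  Complex.log (μ i) / T

/-- The matrix `Λ`: `Λ(i,i) = λᵢ`, `Λ(i,i+1) = 1/(T μᵢ)` inside a block, zeros elsewhere. -/
def floquetMatrix {n : ℕ} (T : ℝ) (μ : Fin n → ℂ) (s : Fin n → Bool) : Matrix (Fin n) (Fin n) ℂ :=
  jordanMatrix (floquetExponent T μ) (fun i => 1 / (T * μ i)) s

/-- The columns of `Ψ` are a basis of generalized eigenvectors of `M` on which `M` acts as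
`e^{TΛ}`. -/
def IsNormalizedBasis {n : ℕ} (T : ℝ) (M : Matrix (Fin n) (Fin n) ℂ) (μ : Fin n → ℂ)
    (s : Fin n → Bool) (Ψ : Matrix (Fin n) (Fin n) ℂ) : Prop :=
  IsUnit Ψ.det ∧ M * Ψ = Ψ * NormedSpace.exp ((T : ℂ) • floquetMatrix T μ s)

/-- The initial value problems
`v̇ⱼ = (A(t) - λⱼ) vⱼ - (1/(T μⱼ₋₁)) vⱼ₋₁`, `vⱼ(0) = ψⱼ`, where `ψⱼ` is the `j`-th column of `Ψ` and
where the last term is present only if `j` continues the Jordan block of `j - 1`. -/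
def IsFloquetSolution {n : ℕ} (T : ℝ) (A : ℝ → Matrix (Fin n) (Fin n) ℂ) (μ : Fin n → ℂ)
    (s : Fin n → Bool) (Ψ : Matrix (Fin n) (Fin n) ℂ) (v : Fin n → ℝ → Fin n → ℂ) : Prop :=
  ∀ j, v j 0 = (fun i => Ψ i j) ∧ (∀ i, LocAbsCont (fun t => v j t i)) ∧
    ∀ᵐ t : ℝ, HasDerivAt (v j)
      (A t *ᵥ v j t - floquetExponent T μ j • v j t
        - ∑ i, if Link s i j then (1 / (T * μ i)) • v i t else 0) t

/-! ### Harmonic operators on `ℓ²` -/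

/-- The `k`-th phasor `(1/T) ∫₀ᵀ a(τ) e^{-jωkτ} dτ`, `ω = 2π/T`, of a `T`-periodic function. -/
def phasor (T : ℝ) (a : ℝ → ℂ) (k : ℤ) : ℂ :=
  (1 / T) * ∫ τ in (0 : ℝ)..T, a τ * Complex.exp (-(Complex.I * (2 * Real.pi / T) * k * τ))

/-- The block Toeplitz matrix `𝒯(A)`: its block `(i,j)` is `(a_{ij,k-l})_{k,l ∈ ℤ}`. -/
def blockToeplitz {n : ℕ} (T : ℝ) (A : ℝ → Matrix (Fin n) (Fin n) ℂ) :
    Matrix (Fin n × ℤ) (Fin n × ℤ) ℂ :=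
  Matrix.of fun p q => phasor T (fun t => A t p.1 q.1) (p.2 - q.2)

/-- `𝒩 = Idₙ ⊗ diag(jωk, k ∈ ℤ)`. -/
def harmonicN (n : ℕ) (T : ℝ) : Matrix (Fin n × ℤ) (Fin n × ℤ) ℂ :=
  (1 : Matrix (Fin n) (Fin n) ℂ) ⊗ₖ
    Matrix.diagonal (fun k : ℤ => Complex.I * (2 * Real.pi / T) * k)

/-- The space `ℓ²(ℂⁿ)` of square summable families indexed by `Fin n × ℤ`. -/
abbrev EllTwo (n : ℕ) : Type := lp (fun _ : Fin n × ℤ => ℂ) 2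

/-- The (in general unbounded) operator on `ℓ²` given by an infinite matrix `M`, on its maximal
domain: all `x ∈ ℓ²` for which the sequence `M x` is defined and belongs to `ℓ²`. -/
def matrixOperator {n : ℕ} (M : Matrix (Fin n × ℤ) (Fin n × ℤ) ℂ) :
    EllTwo n →ₗ.[ℂ] EllTwo n where
  domain :=
    { carrier := {x | ∃ y : EllTwo n, ∀ p, HasSum (fun q => M p q * x q) (y p)}
      zero_mem' := ⟨0, fun p => by simp⟩
      add_mem' := by
        rintro x x' ⟨y, hy⟩ ⟨y', hy'⟩
        exact ⟨y + y', fun p => by simpa [mul_add] using (hy p).add (hy' p)⟩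
      smul_mem' := by
        rintro c x ⟨y, hy⟩
        exact ⟨c • y, fun p => by simpa [mul_left_comm] using (hy p).mul_left c⟩ }
  toFun :=
    { toFun := fun x => x.2.choose
      map_add' := fun x x' => by
        ext p
        refine (Exists.choose_spec (x + x').2 p).unique ?_
        simpa [mul_add] using (x.2.choose_spec p).add (x'.2.choose_spec p)
      map_smul' := fun c x => by
        ext p
        refine (Exists.choose_spec (c • x).2 p).unique ?_
        simpa [mul_left_comm] using (x.2.choose_spec p).mul_left c }

/-- The defining property of `matrixOperator`. -/
theorem matrixOperator_hasSum {n : ℕ} (M : Matrix (Fin n × ℤ) (Fin n × ℤ) ℂ)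
    (x : (matrixOperator M).domain) (p : Fin n × ℤ) :
    HasSum (fun q => M p q * (x : EllTwo n) q) (matrixOperator M x p) :=
  x.2.choose_spec p

/-- The bounded operator `B` on `ℓ²` is the one given by the infinite matrix `M`. -/
def IsMatrixOf {n : ℕ} (M : Matrix (Fin n × ℤ) (Fin n × ℤ) ℂ) (B : EllTwo n →L[ℂ] EllTwo n) :
    Prop :=
  ∀ x p, HasSum (fun q => M p q * x q) (B x p)

/-- The unbounded operator `B⁻¹ L B`, with domain `{x | B x ∈ dom L}`. -/
def conjugate {n : ℕ} (B : EllTwo n ≃L[ℂ] EllTwo n) (L : EllTwo n →ₗ.[ℂ] EllTwo n) :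
    EllTwo n →ₗ.[ℂ] EllTwo n where
  domain := L.domain.comap (B : EllTwo n →ₗ[ℂ] EllTwo n)
  toFun := (B.symm : EllTwo n →ₗ[ℂ] EllTwo n) ∘ₗ L.toFun ∘ₗ
    ((B : EllTwo n →ₗ[ℂ] EllTwo n).restrict (fun _ hx => hx))

end Floquet

end

/-!
Variation of constants: `W(t) = Φ(t,0) Ψ e^{-tΛ}` is the only absolutely continuous solution of
`Ẇ = A W - W Λ`, `W(0) = Ψ`, and columnwise this equation is the system of the `vⱼ`. It is
`T`-periodic because `Φ(t+T,0) = Φ(t,0) Φ(T,0)` and `Φ(T,0) Ψ = Ψ e^{TΛ}`. A normalized `Ψ` exists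
because on a Jordan block of eigenvalue `μ` the matrix `e^{TΛ}` is `μ exp(N/μ)`, with `N` the shift,
which differs from the Jordan block `μ + N` only from the second superdiagonal on.

In the frequency domain the same differential equation reads `𝒜 𝒲 = (𝒩 𝒲 - 𝒲 𝒩) + 𝒲 (Λ ⊗ 1)`.
Since `Ẇ` is square integrable on a period, the phasors of `W` and `W⁻¹` are absolutely summable, so
by the Schur test `𝒲` and `𝒯(W⁻¹)` are bounded, and they are inverse to each other. What remains is
to apply the equation to an arbitrary `x ∈ ℓ²` rather than to a finitely supported one. All the
double series involved converge absolutely, because the rows of `𝒜` and of `𝒩 𝒲 - 𝒲 𝒩 = 𝒯(Ẇ)`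
belong to `ℓ²`; their order of summation can therefore be exchanged, which also identifies the
maximal domains.
-/

namespace Floquet

/-! ### Absolutely continuous primitives -/

theorem intervalIntegrable_of_locallyIntegrable {E : Type*} [NormedAddCommGroup E] {f : ℝ → E}
    (hf : LocallyIntegrable f) (a b : ℝ) : IntervalIntegrable f volume a b :=
  (hf.integrableOn_isCompact isCompact_uIcc).intervalIntegrable

theorem locallyIntegrable_of_intervalIntegrable {E : Type*} [NormedAddCommGroup E] {f : ℝ → E}
    (hf : ∀ a b, IntervalIntegrable f volume a b) : LocallyIntegrable f := fun t =>
  ⟨Set.Ioc (t - 1) (t + 1), Ioc_mem_nhds (by linarith) (by linarith), (hf _ _).1⟩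

theorem absolutelyContinuousOnInterval_comp_of_lipschitzOnWith {X Y : Type*}
    [PseudoMetricSpace X] [PseudoMetricSpace Y] {g : X → Y} {f : ℝ → X} {a b : ℝ} {K : NNReal}
    {s : Set X} (hg : LipschitzOnWith K g s) (hf : AbsolutelyContinuousOnInterval f a b)
    (hs : Set.MapsTo f (Set.uIcc a b) s) :
    AbsolutelyContinuousOnInterval (fun t => g (f t)) a b := by
  have hKf : Filter.Tendsto _ _ _ := Filter.Tendsto.const_mul (K : ℝ) hf
  rw [mul_zero] at hKf
  refine squeeze_zero' (.of_forall fun _ => Finset.sum_nonneg fun _ _ => dist_nonneg) ?_ hKf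
  rw [Filter.eventually_inf_principal]
  filter_upwards with E hE
  rw [Finset.mul_sum]
  exact Finset.sum_le_sum fun i hi =>
    hg.dist_le_mul _ (hs (hE.1 i hi).1) _ (hs (hE.1 i hi).2)

theorem LocAbsCont.add {f g : ℝ → ℂ} (hf : LocAbsCont f) (hg : LocAbsCont g) :
    LocAbsCont (fun t => f t + g t) :=
  fun a b => (hf a b).fun_add (hg a b)

theorem LocAbsCont.mul {f g : ℝ → ℂ} (hf : LocAbsCont f) (hg : LocAbsCont g) :
    LocAbsCont (fun t => f t * g t) :=
  fun a b => (hf a b).fun_smul (hg a b)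

theorem locAbsCont_of_contDiff {f : ℝ → ℂ} (hf : ContDiff ℝ 1 f) : LocAbsCont f :=
  fun _ _ => hf.contDiffOn.absolutelyContinuousOnInterval

theorem LocAbsCont.continuous {f : ℝ → ℂ} (hf : LocAbsCont f) : Continuous f := by
  refine continuous_iff_continuousAt.2 fun t => ?_
  refine (hf (t - 1) (t + 1)).continuousOn.continuousAt ?_
  rw [Set.uIcc_of_le (by linarith)]
  exact Icc_mem_nhds (by linarith) (by linarith)

theorem LocAbsCont.comp_add_right {f : ℝ → ℂ} (hf : LocAbsCont f) (T : ℝ) :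
    LocAbsCont fun t => f (t + T) := by
  intro a b
  rw [absolutelyContinuousOnInterval_iff]
  intro ε hε
  obtain ⟨δ, hδ, hfδ⟩ := (absolutelyContinuousOnInterval_iff f (a + T) (b + T)).1
    (hf (a + T) (b + T)) ε hε
  refine ⟨δ, hδ, fun E hE hEδ => ?_⟩
  refine hfδ (E.1, fun i => ((E.2 i).1 + T, (E.2 i).2 + T)) ⟨fun i hi => ?_, ?_⟩ ?_
  · simpa only [← Set.image_add_const_uIcc, (add_left_injective T).mem_set_image] using hE.1 i hi
  · refine fun i hi j hj hij => Set.disjoint_left.2 fun x hxi hxj => ?_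
    refine Set.disjoint_left.1 (hE.2 hi hj hij) (show x - T ∈ _ from ?_) ?_ <;>
      grind [Set.mem_uIoc]
  · simpa only [dist_add_right] using hEδ

theorem absolutelyContinuousOnInterval_integral {g : ℝ → ℝ} (hg : LocallyIntegrable g)
    (c a b : ℝ) : AbsolutelyContinuousOnInterval (fun t => ∫ τ in c..t, g τ) a b := by
  have hc : c ∈ Set.uIcc (min c (min a b)) (max c (max a b)) := by
    simp [Set.uIcc_of_le]
  refine ((intervalIntegrable_of_locallyIntegrable hg _ _
    ).absolutelyContinuousOnInterval_intervalIntegral hc).mono ?_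
  rw [Set.uIcc_of_le (by simp : min c (min a b) ≤ max c (max a b))]
  exact Set.Icc_subset_Icc (min_le_right _ _) (le_max_right _ _)

theorem locAbsCont_of_re_im {f : ℝ → ℂ}
    (hre : ∀ a b, AbsolutelyContinuousOnInterval (fun t => (f t).re) a b)
    (him : ∀ a b, AbsolutelyContinuousOnInterval (fun t => (f t).im) a b) : LocAbsCont f := by
  intro a b
  have hconst : ∀ z : ℂ, LocAbsCont fun _ => z := fun z => locAbsCont_of_contDiff contDiff_const
  have := ((hre a b).fun_smul (hconst 1 a b)).fun_add ((him a b).fun_smul (hconst Complex.I a b))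
  simpa [Complex.re_add_im] using this

theorem locAbsCont_integral {g : ℝ → ℂ} (hg : LocallyIntegrable g) (c : ℝ) :
    LocAbsCont fun t => ∫ τ in c..t, g τ := by
  have hint := intervalIntegrable_of_locallyIntegrable hg
  refine locAbsCont_of_re_im (fun a b => ?_) fun a b => ?_
  · have hre : LocallyIntegrable fun t => (g t).re := hg.mono
      (Complex.continuous_re.comp_aestronglyMeasurable hg.aestronglyMeasurable)
      (.of_forall fun t => Complex.abs_re_le_norm (g t))
    convert absolutelyContinuousOnInterval_integral hre c a b using 2 with t
    exact (Complex.reCLM.intervalIntegral_comp_comm (hint c t)).symm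
  · have him : LocallyIntegrable fun t => (g t).im := hg.mono
      (Complex.continuous_im.comp_aestronglyMeasurable hg.aestronglyMeasurable)
      (.of_forall fun t => Complex.abs_im_le_norm (g t))
    convert absolutelyContinuousOnInterval_integral him c a b using 2 with t
    exact (Complex.imCLM.intervalIntegral_comp_comm (hint c t)).symm

/-- `f` is locally absolutely continuous with derivative `g` almost everywhere: the calculus in
which Carathéodory solutions are handled. -/
def IsPrimitive (f g : ℝ → ℂ) : Prop :=
  LocAbsCont f ∧ ∀ᵐ t : ℝ, HasDerivAt f (g t) t

namespace IsPrimitive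

variable {f g f' g' : ℝ → ℂ}

theorem continuous (hf : IsPrimitive f f') : Continuous f := hf.1.continuous

theorem congr (hf : IsPrimitive f f') (h : ∀ t, f' t = g' t) : IsPrimitive f g' :=
  (funext h : f' = g') ▸ hf

theorem add (hf : IsPrimitive f f') (hg : IsPrimitive g g') :
    IsPrimitive (fun t => f t + g t) (fun t => f' t + g' t) := by
  refine ⟨hf.1.add hg.1, ?_⟩
  filter_upwards [hf.2, hg.2] with t hft hgt using hft.add hgt

theorem mul (hf : IsPrimitive f f') (hg : IsPrimitive g g') :
    IsPrimitive (fun t => f t * g t) (fun t => f' t * g t + f t * g' t) := by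
  refine ⟨hf.1.mul hg.1, ?_⟩
  filter_upwards [hf.2, hg.2] with t hft hgt using hft.mul hgt

theorem const (c : ℂ) : IsPrimitive (fun _ => c) (fun _ => 0) :=
  ⟨locAbsCont_of_contDiff contDiff_const, .of_forall fun t => hasDerivAt_const t c⟩

theorem neg (hf : IsPrimitive f f') : IsPrimitive (fun t => -f t) (fun t => -f' t) := by
  simpa using (const (-1)).mul hf

theorem sum {ι : Type*} (s : Finset ι) {f f' : ι → ℝ → ℂ}
    (h : ∀ i ∈ s, IsPrimitive (f i) (f' i)) :
    IsPrimitive (fun t => ∑ i ∈ s, f i t) (fun t => ∑ i ∈ s, f' i t) := by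
  classical
  induction s using Finset.induction_on with
  | empty => simpa using const 0
  | insert a s ha ih =>
    simp only [Finset.sum_insert ha]
    exact (h a (Finset.mem_insert_self a s)).add
      (ih fun i hi => h i (Finset.mem_insert_of_mem hi))

theorem of_hasDerivAt (h : ∀ t, HasDerivAt f (f' t) t) (hc : Continuous f') :
    IsPrimitive f f' := by
  have hderiv : deriv f = f' := funext fun t => (h t).deriv
  exact ⟨locAbsCont_of_contDiff
    (contDiff_one_iff_deriv.2 ⟨fun t => (h t).differentiableAt, hderiv ▸ hc⟩), .of_forall h⟩

theorem integral (hg : LocallyIntegrable g) (c : ℝ) :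
    IsPrimitive (fun t => ∫ τ in c..t, g τ) g :=
  ⟨locAbsCont_integral hg c,
    (LocallyIntegrable.ae_hasDerivAt_integral hg).mono fun _ ht => ht c⟩

theorem eq_of_deriv_zero (h : IsPrimitive f (fun _ => 0)) (a b : ℝ) : f a = f b := by
  obtain ⟨C, hC⟩ := (h.1 a b).const_of_ae_hasDerivAt_zero (h.2.mono fun t ht _ => ht)
  rw [hC a (by simp), hC b (by simp)]

theorem intervalIntegrable_clm_apply (h : IsPrimitive f g) (L : ℂ →L[ℝ] ℝ) (a b : ℝ) :
    IntervalIntegrable (fun t => L (g t)) volume a b := by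
  have hL : AbsolutelyContinuousOnInterval (fun t => L (f t)) a b :=
    absolutelyContinuousOnInterval_comp_of_lipschitzOnWith L.lipschitz.lipschitzOnWith (h.1 a b)
      (Set.mapsTo_univ _ _)
  refine hL.intervalIntegrable_deriv.congr_ae (ae_restrict_of_ae (h.2.mono fun t ht => ?_))
  exact (L.hasFDerivAt.comp_hasDerivAt t ht).deriv

theorem locallyIntegrable (h : IsPrimitive f g) : LocallyIntegrable g := by
  refine locallyIntegrable_of_intervalIntegrable fun a b => ?_
  have hre := h.intervalIntegrable_clm_apply Complex.reCLM a b
  have him := h.intervalIntegrable_clm_apply Complex.imCLM a b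
  have hre' : IntervalIntegrable (fun t => ((g t).re : ℂ)) volume a b :=
    ⟨hre.1.ofReal, hre.2.ofReal⟩
  have him' : IntervalIntegrable (fun t => ((g t).im : ℂ)) volume a b :=
    ⟨him.1.ofReal, him.2.ofReal⟩
  simpa [Complex.re_add_im] using hre'.add (him'.mul_const Complex.I)

theorem eq_add_integral (h : IsPrimitive f g) (a t : ℝ) : f t = f a + ∫ τ in a..t, g τ := by
  have hdiff : IsPrimitive (fun t => f t + -∫ τ in a..t, g τ) fun _ => 0 :=
    (h.add (integral h.locallyIntegrable a).neg).congr fun t => add_neg_cancel (g t)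
  have := hdiff.eq_of_deriv_zero t a
  simp only [intervalIntegral.integral_same] at this
  linear_combination this

theorem comp_add_right (h : IsPrimitive f g) (T : ℝ) :
    IsPrimitive (fun t => f (t + T)) (fun t => g (t + T)) := by
  refine ⟨fun a b => h.1.comp_add_right T a b, ?_⟩
  filter_upwards [(measurePreserving_add_right volume T).quasiMeasurePreserving.ae h.2] with t ht
  exact ht.comp_add_const t T

end IsPrimitive

/-- The entrywise version of `IsPrimitive` for matrix functions. -/
def IsMatPrimitive {m p : Type*} (F G : ℝ → Matrix m p ℂ) : Prop :=
  ∀ i j, IsPrimitive (fun t => F t i j) (fun t => G t i j)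

namespace IsMatPrimitive

variable {l m p : Type*} {F F' G' : ℝ → Matrix l m ℂ}

theorem congr (hF : IsMatPrimitive F F') (h : ∀ t, F' t = G' t) : IsMatPrimitive F G' :=
  (funext h : F' = G') ▸ hF

theorem const (C : Matrix l m ℂ) : IsMatPrimitive (fun _ => C) (fun _ => 0) :=
  fun i j => .const (C i j)

theorem mul [Fintype m] (hF : IsMatPrimitive F F') {G G' : ℝ → Matrix m p ℂ}
    (hG : IsMatPrimitive G G') :
    IsMatPrimitive (fun t => F t * G t) (fun t => F' t * G t + F t * G' t) := by
  intro i j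
  simp only [Matrix.mul_apply, Matrix.add_apply, ← Finset.sum_add_distrib]
  exact .sum Finset.univ fun k _ => (hF i k).mul (hG k j)

theorem mulVec [Fintype m] (hF : IsMatPrimitive F F') {x x' : ℝ → m → ℂ}
    (hx : ∀ i, IsPrimitive (fun t => x t i) (fun t => x' t i)) (i : l) :
    IsPrimitive (fun t => (F t *ᵥ x t) i) (fun t => (F' t *ᵥ x t + F t *ᵥ x' t) i) :=
  hF.mul (G := fun t => Matrix.replicateCol Unit (x t))
    (G' := fun t => Matrix.replicateCol Unit (x' t)) (fun i _ => hx i) i ()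

theorem eq_of_deriv_zero (h : IsMatPrimitive F (fun _ => 0)) (a b : ℝ) : F a = F b := by
  ext i j
  exact (h i j).eq_of_deriv_zero a b

theorem ae_hasDerivAt [Finite l] [Finite m] (h : IsMatPrimitive F F') :
    ∀ᵐ t : ℝ, ∀ i j, HasDerivAt (fun τ => F τ i j) (F' t i j) t :=
  Filter.eventually_all.2 fun i => Filter.eventually_all.2 fun j => (h i j).2

end IsMatPrimitive

/-! ### Linear equations with locally integrable coefficients -/

theorem absolutelyContinuousOnInterval_sinh_comp {f : ℝ → ℝ} {a b : ℝ}
    (hf : AbsolutelyContinuousOnInterval f a b) :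
    AbsolutelyContinuousOnInterval (fun t => Real.sinh (f t)) a b := by
  obtain ⟨C, hC⟩ := hf.exists_bound
  obtain ⟨K, hK⟩ := (Real.contDiff_sinh (n := 1)).contDiffOn.exists_lipschitzOnWith
    (s := Set.Icc (-C) C) one_ne_zero (convex_Icc _ _) isCompact_Icc
  exact absolutelyContinuousOnInterval_comp_of_lipschitzOnWith hK hf
    fun t ht => abs_le.1 (hC t ht)

/-- The weight `cosh (2 ∫₀ᵗ α)` with which continuous functions are normed in order to make
integration against `α` a contraction. -/
noncomputable def coshWeight (α : ℝ → ℝ) (t : ℝ) : ℝ :=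
  Real.cosh (2 * ∫ τ in (0 : ℝ)..t, α τ)

section CoshWeight

variable {α : ℝ → ℝ}

theorem one_le_coshWeight (t : ℝ) : 1 ≤ coshWeight α t := Real.one_le_cosh _

theorem coshWeight_pos (t : ℝ) : 0 < coshWeight α t := Real.cosh_pos _

theorem continuous_coshWeight (hα : LocallyIntegrable α) : Continuous (coshWeight α) :=
  Real.continuous_cosh.comp (continuous_const.mul
    (intervalIntegral.continuous_primitive (intervalIntegrable_of_locallyIntegrable hα) 0))

theorem integral_mul_coshWeight (hα : LocallyIntegrable α) (t : ℝ) :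
    ∫ τ in (0 : ℝ)..t, α τ * coshWeight α τ = Real.sinh (2 * ∫ τ in (0 : ℝ)..t, α τ) / 2 := by
  have hac := absolutelyContinuousOnInterval_sinh_comp
    ((absolutelyContinuousOnInterval_integral hα 0 0 t).const_mul 2)
  have hderiv : ∀ᵐ τ : ℝ, deriv (fun t => Real.sinh (2 * ∫ τ in (0 : ℝ)..t, α τ)) τ =
      2 * (α τ * coshWeight α τ) := by
    filter_upwards [LocallyIntegrable.ae_hasDerivAt_integral hα] with τ hτ
    rw [((hτ 0).const_mul 2).sinh.deriv, coshWeight]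
    ring
  have hftc := hac.integral_deriv_eq_sub
  rw [intervalIntegral.integral_congr_ae (hderiv.mono fun τ hτ _ => hτ),
    intervalIntegral.integral_const_mul] at hftc
  simp only [intervalIntegral.integral_same, mul_zero, Real.sinh_zero, sub_zero] at hftc
  linarith

theorem abs_integral_mul_coshWeight_le (hα : LocallyIntegrable α) (t : ℝ) :
    |∫ τ in (0 : ℝ)..t, α τ * coshWeight α τ| ≤ coshWeight α t / 2 := by
  rw [integral_mul_coshWeight hα, abs_div, abs_two, Real.abs_sinh, coshWeight, ← Real.cosh_abs]
  gcongr
  exact (Real.sinh_lt_cosh _).le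

end CoshWeight

theorem norm_integral_le_coshWeight {E : Type*} [NormedAddCommGroup E] [NormedSpace ℝ E]
    {α : ℝ → ℝ} (hα : LocallyIntegrable α) {f : ℝ → E} {C : ℝ} (hC : 0 ≤ C)
    (hf : ∀ t, ‖f t‖ ≤ α t * (coshWeight α t * C)) (t : ℝ) :
    ‖∫ τ in (0 : ℝ)..t, f τ‖ ≤ coshWeight α t / 2 * C := by
  have hw : LocallyIntegrable fun τ => α τ * coshWeight α τ :=
    hα.mul_continuous (continuous_coshWeight hα)
  calc ‖∫ τ in (0 : ℝ)..t, f τ‖ ≤ |∫ τ in (0 : ℝ)..t, α τ * coshWeight α τ * C| :=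
        intervalIntegral.norm_integral_le_abs_of_norm_le
          (.of_forall fun τ => (hf τ).trans_eq (mul_assoc _ _ _).symm)
          ((intervalIntegrable_of_locallyIntegrable hw 0 t).mul_const C)
    _ = |∫ τ in (0 : ℝ)..t, α τ * coshWeight α τ| * C := by
        rw [intervalIntegral.integral_mul_const, abs_mul, abs_of_nonneg hC]
    _ ≤ coshWeight α t / 2 * C := by
        gcongr
        exact abs_integral_mul_coshWeight_le hα t

section Volterra

open scoped BoundedContinuousFunction

variable {E : Type*} [NormedAddCommGroup E] [NormedSpace ℝ E] {B : ℝ → E →ₗ[ℝ] E} {α : ℝ → ℝ}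

/-- With `w` the weight and `x = w y`, the operator `x ↦ ∫₀ᵗ B x` becomes a contraction of the
bounded functions `y`. -/
theorem exists_weighted_volterra_operator (hα : LocallyIntegrable α) (hα_nonneg : ∀ t, 0 ≤ α t)
    (hBα : ∀ t v, ‖B t v‖ ≤ α t * ‖v‖)
    (hB : ∀ x : ℝ → E, Continuous x → LocallyIntegrable fun t => B t (x t)) :
    ∃ L : (ℝ →ᵇ E) →L[ℝ] (ℝ →ᵇ E), ‖L‖ ≤ 1 / 2 ∧ ∀ y t, L y t =
      (coshWeight α t)⁻¹ • ∫ τ in (0 : ℝ)..t, B τ (coshWeight α τ • y τ) := by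
  set w := coshWeight α
  have hw : Continuous w := continuous_coshWeight hα
  have hw_pos : ∀ t, 0 < w t := coshWeight_pos
  have hint : ∀ (y : ℝ →ᵇ E) (a b : ℝ), IntervalIntegrable (fun τ => B τ (w τ • y τ)) volume a b :=
    fun y => intervalIntegrable_of_locallyIntegrable (hB _ (hw.smul y.continuous))
  have hnorm : ∀ (y : ℝ →ᵇ E) t,
      ‖(w t)⁻¹ • ∫ τ in (0 : ℝ)..t, B τ (w τ • y τ)‖ ≤ 1 / 2 * ‖y‖ := by
    intro y t
    rw [norm_smul, norm_inv, Real.norm_of_nonneg (hw_pos t).le, inv_mul_le_iff₀ (hw_pos t)]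
    refine (norm_integral_le_coshWeight hα (norm_nonneg y) (fun τ => ?_) t).trans_eq (by ring)
    refine (hBα τ _).trans (mul_le_mul_of_nonneg_left ?_ (hα_nonneg τ))
    rw [norm_smul, Real.norm_of_nonneg (hw_pos τ).le]
    exact mul_le_mul_of_nonneg_left (y.norm_coe_le_norm τ) (hw_pos τ).le
  refine ⟨LinearMap.mkContinuous
    { toFun := fun y => .ofNormedAddCommGroup
        (fun t => (w t)⁻¹ • ∫ τ in (0 : ℝ)..t, B τ (w τ • y τ))
        ((hw.inv₀ fun t => (hw_pos t).ne').smul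
          (intervalIntegral.continuous_primitive (hint y) 0)) _ (hnorm y)
      map_add' := fun y z => ?_
      map_smul' := fun c y => ?_ } (1 / 2) (fun y => ?_),
    LinearMap.mkContinuous_norm_le _ (by norm_num) _, fun y t => rfl⟩
  · ext t
    have hadd := intervalIntegral.integral_add (hint y 0 t) (hint z 0 t)
    simp only [← map_add, ← smul_add] at hadd
    exact (congrArg ((w t)⁻¹ • ·) hadd).trans (smul_add _ _ _)
  · ext t
    simp [smul_comm _ c, intervalIntegral.integral_smul]
  · exact (BoundedContinuousFunction.norm_le (by positivity)).2 (hnorm y)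

/-- The weighted integral operator has norm at most `1 / 2`, so `1 - L` is inverted by a Neumann
series. -/
theorem exists_eq_add_integral_apply [CompleteSpace E] (hα : LocallyIntegrable α)
    (hα_nonneg : ∀ t, 0 ≤ α t) (hBα : ∀ t v, ‖B t v‖ ≤ α t * ‖v‖)
    (hB : ∀ x : ℝ → E, Continuous x → LocallyIntegrable fun t => B t (x t)) (x₀ : E) :
    ∃ x : ℝ → E, Continuous x ∧ ∀ t, x t = x₀ + ∫ τ in (0 : ℝ)..t, B τ (x τ) := by
  obtain ⟨L, hL, hL_apply⟩ := exists_weighted_volterra_operator hα hα_nonneg hBα hB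
  set w := coshWeight α
  have hw : Continuous w := continuous_coshWeight hα
  have hw_pos : ∀ t, 0 < w t := coshWeight_pos
  let y₀ : ℝ →ᵇ E := .ofNormedAddCommGroup (fun t => (w t)⁻¹ • x₀)
    ((hw.inv₀ fun t => (hw_pos t).ne').smul continuous_const) ‖x₀‖ fun t => by
      rw [norm_smul, norm_inv, Real.norm_of_nonneg (hw_pos t).le]
      exact mul_le_of_le_one_left (norm_nonneg _) (inv_le_one_of_one_le₀ (one_le_coshWeight t))
  obtain ⟨U, hU⟩ := isUnit_one_sub_of_norm_lt_one (hL.trans_lt one_half_lt_one)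
  let y := U⁻¹.val y₀
  have hy : y - L y = y₀ := by
    have := congrArg (fun M : (ℝ →ᵇ E) →L[ℝ] (ℝ →ᵇ E) => M y₀) U.mul_inv
    rwa [hU] at this
  refine ⟨fun t => w t • y t, hw.smul y.continuous, fun t => ?_⟩
  have hyt : y t = (w t)⁻¹ • x₀ + (w t)⁻¹ • ∫ τ in (0 : ℝ)..t, B τ (w τ • y τ) := by
    rw [← hL_apply]
    exact eq_add_of_sub_eq (congrArg (fun z : ℝ →ᵇ E => z t) hy)
  calc w t • y t = w t • (w t)⁻¹ • (x₀ + ∫ τ in (0 : ℝ)..t, B τ (w τ • y τ)) := by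
        rw [smul_add, ← hyt]
    _ = _ := smul_inv_smul₀ (hw_pos t).ne' _

end Volterra

section LinearSystem

variable {ι : Type*} [Fintype ι] {A : ℝ → Matrix ι ι ℂ}

theorem norm_mulVec_le_sum_norm_mul_norm {m p : Type*} [Fintype m] [Fintype p] (M : Matrix m p ℂ)
    (v : p → ℂ) : ‖M *ᵥ v‖ ≤ (∑ i, ∑ j, ‖M i j‖) * ‖v‖ := by
  refine (pi_norm_le_iff_of_nonneg (by positivity)).2 fun i => ?_
  calc ‖(M *ᵥ v) i‖ ≤ ∑ j, ‖M i j‖ * ‖v‖ := norm_sum_le_of_le _ fun j _ => by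
        rw [norm_mul]
        exact mul_le_mul_of_nonneg_left (norm_le_pi_norm v j) (norm_nonneg _)
    _ = (∑ j, ‖M i j‖) * ‖v‖ := (Finset.sum_mul _ _ _).symm
    _ ≤ (∑ i, ∑ j, ‖M i j‖) * ‖v‖ := by
        gcongr
        exact Finset.single_le_sum (f := fun i => ∑ j, ‖M i j‖)
          (fun i _ => Finset.sum_nonneg fun j _ => norm_nonneg _) (Finset.mem_univ i)

theorem locallyIntegrable_mulVec_apply (hA : ∀ i j, LocallyIntegrable fun t => A t i j)
    {x : ℝ → ι → ℂ} (hx : Continuous x) (i : ι) : LocallyIntegrable fun t => (A t *ᵥ x t) i :=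
  locallyIntegrable_finsetSum _ fun j _ =>
    (hA i j).mul_continuous ((continuous_apply j).comp hx)

theorem locallyIntegrable_mulVec (hA : ∀ i j, LocallyIntegrable fun t => A t i j) {x : ℝ → ι → ℂ}
    (hx : Continuous x) : LocallyIntegrable fun t => A t *ᵥ x t :=
  locallyIntegrable_iff.2 fun _ hK => .of_eval fun i =>
    (locallyIntegrable_mulVec_apply hA hx i).integrableOn_isCompact hK

theorem exists_isPrimitive_mulVec (hA : ∀ i j, LocallyIntegrable fun t => A t i j) (x₀ : ι → ℂ) :
    ∃ x : ℝ → ι → ℂ, x 0 = x₀ ∧ ∀ i, IsPrimitive (fun t => x t i) (fun t => (A t *ᵥ x t) i) := by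
  have hα : LocallyIntegrable fun t => ∑ i, ∑ j, ‖A t i j‖ :=
    locallyIntegrable_finsetSum _ fun i _ => locallyIntegrable_finsetSum _ fun j _ t =>
      (hA i j t).norm
  obtain ⟨x, hx, hx_eq⟩ := exists_eq_add_integral_apply
    (B := fun t => (A t).mulVecLin.restrictScalars ℝ) hα (fun t => by positivity)
    (fun t v => norm_mulVec_le_sum_norm_mul_norm (A t) v)
    (fun x hx => locallyIntegrable_mulVec hA hx) x₀
  refine ⟨x, by simp [hx_eq 0], fun i => ?_⟩
  have hx_entry : (fun t => x t i) = fun t => x₀ i + ∫ τ in (0 : ℝ)..t, (A τ *ᵥ x τ) i := by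
    funext t
    have hproj := (ContinuousLinearMap.proj (R := ℝ) (φ := fun _ : ι => ℂ) i
      ).intervalIntegral_comp_comm
        (intervalIntegrable_of_locallyIntegrable (locallyIntegrable_mulVec hA hx) 0 t)
    simp only [ContinuousLinearMap.proj_apply] at hproj
    rw [hproj]
    exact congrFun (hx_eq t) i
  rw [hx_entry]
  simpa only [zero_add] using
    (IsPrimitive.const (x₀ i)).add (.integral (locallyIntegrable_mulVec_apply hA hx i) 0)

theorem exists_fundamental_matrix [DecidableEq ι] (hA : ∀ i j, LocallyIntegrable fun t => A t i j) :
    ∃ Φ : ℝ → Matrix ι ι ℂ, Φ 0 = 1 ∧ IsMatPrimitive Φ (fun t => A t * Φ t) := by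
  choose x hx₀ hx using fun j : ι => exists_isPrimitive_mulVec hA (Pi.single j 1)
  refine ⟨fun t => Matrix.of fun i j => x j t i, ?_, fun i j => hx j i⟩
  ext i j
  simp [hx₀, Matrix.one_apply, Pi.single_apply]

/-- `Φ⁻¹` is the solution of the adjoint equation `Ż = -Z A`: this gives its absolute continuity. -/
theorem isMatPrimitive_inv_fundamental_matrix [DecidableEq ι] {Φ : ℝ → Matrix ι ι ℂ}
    (hA : ∀ i j, LocallyIntegrable fun t => A t i j) (hΦ0 : Φ 0 = 1)
    (hΦ : IsMatPrimitive Φ fun t => A t * Φ t) :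
    (∀ t, IsUnit (Φ t).det) ∧ IsMatPrimitive (fun t => (Φ t)⁻¹) fun t => -((Φ t)⁻¹ * A t) := by
  obtain ⟨Y, hY0, hY⟩ := exists_fundamental_matrix (A := fun t => -(A t)ᵀ)
    fun i j => (hA j i).neg
  have hZ : IsMatPrimitive (fun t => (Y t)ᵀ) (fun t => -((Y t)ᵀ * A t)) := fun i j =>
    (hY j i).congr fun t => by simp [Matrix.mul_apply, mul_comm]
  have hconst : IsMatPrimitive (fun t => (Y t)ᵀ * Φ t) fun _ => 0 :=
    (hZ.mul hΦ).congr fun t => by simp [Matrix.mul_assoc]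
  have hZΦ : ∀ t, (Y t)ᵀ * Φ t = 1 := fun t => by
    simpa [hΦ0, hY0] using hconst.eq_of_deriv_zero t 0
  simp only [fun t => Matrix.inv_eq_left_inv (hZΦ t)]
  exact ⟨fun t => Matrix.isUnit_det_of_left_inverse (hZΦ t), hZ⟩

theorem isMatPrimitive_exp_smul [DecidableEq ι] (M : Matrix ι ι ℂ) :
    IsMatPrimitive (fun t : ℝ => NormedSpace.exp ((t : ℂ) • M))
      (fun t => M * NormedSpace.exp ((t : ℂ) • M)) := by
  let _ : NormedRing (Matrix ι ι ℂ) := Matrix.linftyOpNormedRing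
  let _ : NormedAlgebra ℝ (Matrix ι ι ℂ) := Matrix.linftyOpNormedAlgebra
  intro i j
  let entry : Matrix ι ι ℂ →L[ℝ] ℂ :=
    ⟨Matrix.entryLinearMap ℝ ℂ i j, continuous_apply_apply i j⟩
  have hderiv := fun t : ℝ => hasDerivAt_exp_smul_const' (𝕂 := ℝ) M t
  have hcont : Continuous fun t : ℝ => NormedSpace.exp (t • M) :=
    continuous_iff_continuousAt.2 fun t => (hderiv t).continuousAt
  simp only [Complex.coe_smul]
  exact .of_hasDerivAt (fun t => entry.hasFDerivAt.comp_hasDerivAt t (hderiv t))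
    (entry.continuous.comp (continuous_const.mul hcont))

theorem isSolution_iff_isPrimitive {n : ℕ} {A : ℝ → Matrix (Fin n) (Fin n) ℂ}
    {x : ℝ → Fin n → ℂ} :
    IsSolution A x ↔ ∀ i, IsPrimitive (fun t => x t i) (fun t => (A t *ᵥ x t) i) := by
  simp only [IsSolution, IsPrimitive, hasDerivAt_pi, Filter.eventually_all, forall_and]

end LinearSystem

/-! ### Existence of Jordan bases -/

section JordanChain

variable {K V V' : Type*} [Field K] [AddCommGroup V] [Module K V] [AddCommGroup V'] [Module K V']

/-- A Jordan chain of `f` with eigenvalue `μ`, starting at an eigenvector: `f - μ` maps each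
vector of the chain to the preceding one. -/
def IsJordanChain (f : Module.End K V) (μ : K) {e : ℕ} (v : Fin e → V) : Prop :=
  ∀ k : Fin e, f (v k) = μ • v k + if 0 < (k : ℕ) then v ⟨k - 1, by omega⟩ else 0

theorem IsJordanChain.map {f : Module.End K V} {f' : Module.End K V'} {μ : K} {e : ℕ}
    {v : Fin e → V} (hv : IsJordanChain f μ v) (g : V →ₗ[K] V') (hg : ∀ x, g (f x) = f' (g x)) :
    IsJordanChain f' μ fun k => g (v k) := by
  intro k
  rw [← hg, hv k, map_add, map_smul, apply_ite g, map_zero]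

open Polynomial in
theorem exists_basis_isJordanChain_quotient (μ : K) (e : ℕ) :
    ∃ b : Module.Basis (Fin e) K (K[X] ⧸ Ideal.span {(X - C μ) ^ e}),
      IsJordanChain (Algebra.lsmul K K _ (X : K[X])) μ b := by
  let π := Ideal.Quotient.mkₐ K (Ideal.span {(X - C μ) ^ e})
  have hzero : ∀ i, e ≤ i → π ((X - C μ) ^ i) = 0 := fun i hi =>
    Ideal.Quotient.eq_zero_iff_mem.2 (Ideal.mem_span_singleton.2 (pow_dvd_pow _ hi))
  let v : Fin e → K[X] ⧸ Ideal.span {(X - C μ) ^ e} := fun k => π ((X - C μ) ^ (e - 1 - k))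
  have hspan : ⊤ ≤ Submodule.span K (Set.range v) := by
    rintro q -
    obtain ⟨p, rfl⟩ := Ideal.Quotient.mkₐ_surjective K _ q
    rw [← sum_taylor_eq p μ, Polynomial.sum, map_sum]
    refine Submodule.sum_mem _ fun i _ => ?_
    rw [← smul_eq_C_mul, map_smul]
    refine Submodule.smul_mem _ _ ?_
    rcases lt_or_ge i e with hi | hi
    · refine Submodule.subset_span ⟨⟨e - 1 - i, by omega⟩, ?_⟩
      simp only [v, show e - 1 - (e - 1 - i) = i by omega, π]
    · exact (hzero i hi).symm ▸ Submodule.zero_mem _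
  have hcard : Fintype.card (Fin e) = Module.finrank K (K[X] ⧸ Ideal.span {(X - C μ) ^ e}) := by
    rw [finrank_quotient_span_eq_natDegree]
    simp
  refine ⟨basisOfTopLeSpanOfCardEqFinrank v hspan hcard, fun k => ?_⟩
  have hX : ∀ q, Algebra.lsmul K K _ (X : K[X]) (π q) = μ • π q + π ((X - C μ) * q) := fun q => by
    rw [← map_smul, ← map_add, smul_eq_C_mul]
    exact congrArg π (by ring)
  simp only [coe_basisOfTopLeSpanOfCardEqFinrank, v, hX, ← pow_succ']
  congr 1
  split_ifs with hk
  · congr 2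
    omega
  · exact hzero _ (by omega)

theorem isTorsion_aeval' [FiniteDimensional K V] (f : Module.End K V) :
    Module.IsTorsion (Polynomial K) (Module.AEval' f) := by
  intro x
  obtain ⟨p, hp, hpf⟩ := LinearMap.isIntegral (R := K) f
  refine ⟨⟨p, mem_nonZeroDivisors_of_ne_zero hp.ne_zero⟩, ?_⟩
  have hsmul := Module.AEval.of_aeval_smul (R := K) (a := f) p ((Module.AEval'.of f).symm x)
  rw [show Polynomial.aeval f p = 0 from hpf] at hsmul
  simpa using hsmul.symm

/-- As a torsion `K[X]`-module, `V` is a direct sum of modules `K[X] ⧸ (X - μ) ^ e`, on which `f`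
acts as multiplication by `X`. -/
theorem exists_basis_isJordanChain [IsAlgClosed K] [FiniteDimensional K V] (f : Module.End K V) :
    ∃ (m : ℕ) (e : Fin m → ℕ) (ν : Fin m → K) (b : Module.Basis (Σ i, Fin (e i)) K V),
      ∀ i, IsJordanChain f (ν i) fun k => b ⟨i, k⟩ := by
  classical
  obtain ⟨ι, _, p, hp, e, ⟨Θ⟩⟩ := Module.equiv_directSum_of_isTorsion (isTorsion_aeval' f)
  have hlinear : ∀ i, ∃ μ : K, Ideal.span {p i ^ e i} =
      Ideal.span {(Polynomial.X - Polynomial.C μ) ^ e i} := fun i => by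
    obtain ⟨μ, hμ⟩ := IsAlgClosed.exists_root (p i) (hp i).degree_pos.ne'
    exact ⟨μ, Ideal.span_singleton_eq_span_singleton.2
      (((Polynomial.irreducible_X_sub_C μ).associated_of_dvd (hp i)
        (Polynomial.dvd_iff_isRoot.2 hμ)).pow_pow).symm⟩
  choose μ hμ using hlinear
  have hblock : ∀ i, ∃ b : Module.Basis (Fin (e i)) K (Polynomial K ⧸ Ideal.span {p i ^ e i}),
      IsJordanChain (Algebra.lsmul K K _ (Polynomial.X : Polynomial K)) (μ i) b := fun i =>
    hμ i ▸ exists_basis_isJordanChain_quotient (μ i) (e i)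
  choose b hb using hblock
  let Θ' := (Θ.restrictScalars K).symm.trans (Module.AEval'.of f).symm
  let B : Module.Basis (Σ i, Fin (e i)) K V := (DFinsupp.basis b).map Θ'
  let g i : (Polynomial K ⧸ Ideal.span {p i ^ e i}) →ₗ[K] V :=
    Θ'.toLinearMap ∘ₗ (DirectSum.lof (Polynomial K) ι
      (fun i => Polynomial K ⧸ Submodule.span (Polynomial K) {p i ^ e i}) i).restrictScalars K
  have hg : ∀ i q, g i ((Polynomial.X : Polynomial K) • q) = f (g i q) := fun i q => by
    simp only [g, Θ', LinearMap.comp_apply, LinearMap.restrictScalars_apply,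
      LinearEquiv.coe_coe, LinearEquiv.trans_apply, LinearEquiv.restrictScalars_symm_apply]
    rw [map_smul, map_smul]
    exact (Module.AEval'.of_symm_X_smul f _)
  have hB_apply : ∀ i k, B ⟨i, k⟩ = g i (b i k) := fun i k => by
    rw [Module.Basis.map_apply, show DFinsupp.basis b ⟨i, k⟩ = DFinsupp.single i (b i k) by
      simp [DFinsupp.basis]]
    rfl
  have hB : ∀ i, IsJordanChain f (μ i) fun k => B ⟨i, k⟩ := fun i => by
    simpa only [hB_apply] using (hb i).map (g i) (hg i)
  let σ := (Fintype.equivFin ι).symm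
  refine ⟨Fintype.card ι, fun i => e (σ i), fun i => μ (σ i),
    B.reindex (Equiv.sigmaCongrLeft (β := fun i => Fin (e i)) σ).symm, fun i => ?_⟩
  simp only [Module.Basis.reindex_apply, Equiv.symm_symm]
  exact hB (σ i)

end JordanChain

section JordanBasis

variable {n : ℕ} {s : Fin n → Bool}

theorem Link.ne {i j : Fin n} (h : Link s i j) : i ≠ j := by
  rintro rfl
  simp [Link] at h

theorem jordanMatrix_eq_diagonal_add (d c : Fin n → ℂ) (s : Fin n → Bool) :
    jordanMatrix d c s =
      Matrix.diagonal d + Matrix.of fun i j => if Link s i j then c i else 0 := by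
  ext i j
  by_cases h : i = j
  · subst h
    simp [jordanMatrix, show ¬ Link s i i from fun h => h.ne rfl]
  · simp [jordanMatrix, h]

theorem mul_jordanMatrix_apply {m : Type*} (P : Matrix m (Fin n) ℂ) (d c : Fin n → ℂ) (i : m)
    (j : Fin n) : (P * jordanMatrix d c s) i j =
      P i j * d j + ∑ l, if Link s l j then P i l * c l else 0 := by
  rw [jordanMatrix_eq_diagonal_add, Matrix.mul_add, Matrix.add_apply, Matrix.mul_diagonal,
    Matrix.mul_apply]
  simp

theorem jordanMatrix_mul_apply {m : Type*} (P : Matrix (Fin n) m ℂ) (d c : Fin n → ℂ) (i : Fin n)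
    (j : m) : (jordanMatrix d c s * P) i j =
      d i * P i j + ∑ l, if Link s i l then c i * P l j else 0 := by
  rw [jordanMatrix_eq_diagonal_add, Matrix.add_mul, Matrix.add_apply, Matrix.diagonal_mul,
    Matrix.mul_apply]
  simp

theorem nonsing_inv_mul_mul_eq_iff {m : Type*} [Fintype m] [DecidableEq m] {P M J : Matrix m m ℂ}
    (hP : IsUnit P.det) : P⁻¹ * M * P = J ↔ M * P = P * J := by
  rw [Matrix.mul_assoc]
  constructor
  · rintro rfl
    rw [Matrix.mul_nonsing_inv_cancel_left _ _ hP]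
  · intro h
    rw [h, Matrix.nonsing_inv_mul_cancel_left _ _ hP]

/-- The encoding by `s` of consecutive Jordan blocks of sizes `e 0, e 1, …`. -/
def blockLinks {m : ℕ} (e : Fin m → ℕ) (j : Fin (∑ i, e i)) : Bool :=
  decide (0 < ((finSigmaFinEquiv.symm j).2 : ℕ))

theorem blockLinks_finSigmaFinEquiv {m : ℕ} (e : Fin m → ℕ) (i : Fin m) (k : Fin (e i)) :
    blockLinks e (finSigmaFinEquiv ⟨i, k⟩) = decide (0 < (k : ℕ)) := by
  rw [blockLinks, Equiv.symm_apply_apply]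

theorem link_blockLinks_iff {m : ℕ} {e : Fin m → ℕ} {i : Fin m} {k : Fin (e i)}
    {l : Fin (∑ i, e i)} : Link (blockLinks e) l (finSigmaFinEquiv ⟨i, k⟩) ↔
      0 < (k : ℕ) ∧ l = finSigmaFinEquiv ⟨i, ⟨k - 1, by omega⟩⟩ := by
  simp only [Link, blockLinks_finSigmaFinEquiv, decide_eq_true_eq, Fin.ext_iff,
    finSigmaFinEquiv_apply]
  omega

theorem exists_isJordanBasis (M : Matrix (Fin n) (Fin n) ℂ) :
    ∃ (μ : Fin n → ℂ) (s : Fin n → Bool) (P : Matrix (Fin n) (Fin n) ℂ),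
      IsJordanBasis M μ s P := by
  obtain ⟨m, e, ν, b, hb⟩ := exists_basis_isJordanChain (Matrix.toLin' M)
  obtain rfl : n = ∑ i, e i := by simpa using Module.finrank_eq_card_basis b
  let μ : Fin (∑ i, e i) → ℂ := fun j => ν (finSigmaFinEquiv.symm j).1
  let P := (Pi.basisFun ℂ (Fin (∑ i, e i))).toMatrix (b.reindex finSigmaFinEquiv)
  have hP_apply : ∀ a i k, P a (finSigmaFinEquiv ⟨i, k⟩) = b ⟨i, k⟩ a := fun a i k => by
    simp [P, Module.Basis.toMatrix_apply]
  have hP : IsUnit P.det := by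
    have := (Pi.basisFun ℂ (Fin (∑ i, e i))).invertibleToMatrix (b.reindex finSigmaFinEquiv)
    exact Matrix.isUnit_det_of_invertible _
  refine ⟨μ, blockLinks e, P, fun j hj => ?_, hP, (nonsing_inv_mul_mul_eq_iff hP).2 ?_⟩
  · obtain ⟨⟨i, k⟩, rfl⟩ := finSigmaFinEquiv.surjective j
    have hk : 0 < (k : ℕ) := by simpa [blockLinks_finSigmaFinEquiv] using hj
    exact ⟨_, link_blockLinks_iff.2 ⟨hk, rfl⟩, by simp [μ]⟩
  · ext a j
    obtain ⟨⟨i, k⟩, rfl⟩ := finSigmaFinEquiv.surjective j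
    have hMP : (M * P) a (finSigmaFinEquiv ⟨i, k⟩) = (Matrix.toLin' M (b ⟨i, k⟩)) a := by
      simp [Matrix.mul_apply, hP_apply, Matrix.mulVec, dotProduct]
    rw [hMP, hb i k, mul_jordanMatrix_apply, hP_apply]
    simp only [link_blockLinks_iff, mul_one, Pi.add_apply, Pi.smul_apply, smul_eq_mul]
    by_cases hk : 0 < (k : ℕ) <;> simp [hk, hP_apply, μ, mul_comm]

end JordanBasis

/-! ### Powers and exponentials of Jordan matrices -/

section JordanMatrix

variable {n : ℕ} {d c : Fin n → ℂ} {s : Fin n → Bool} {i j k : Fin n}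

theorem Link.left_unique (h : Link s i j) (h' : Link s k j) : i = k :=
  Fin.ext (Nat.succ_injective (h.1.trans h'.1.symm))

theorem Link.right_unique (h : Link s i j) (h' : Link s i k) : j = k :=
  Fin.ext (h.1.symm.trans h'.1)

theorem Link.sum_ite_left {α : Type*} [AddCommMonoid α] (h : Link s i j) (f : Fin n → α) :
    (∑ l, if Link s l j then f l else 0) = f i := by
  have hiff : ∀ l, Link s l j ↔ l = i := fun l => ⟨fun hl => hl.left_unique h, fun e => e ▸ h⟩
  simp [hiff]

theorem Link.sum_ite_right {α : Type*} [AddCommMonoid α] (h : Link s i j) (f : Fin n → α) :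
    (∑ l, if Link s i l then f l else 0) = f j := by
  have hiff : ∀ l, Link s i l ↔ l = j := fun l => ⟨fun hl => hl.right_unique h, fun e => e ▸ h⟩
  simp [hiff]

theorem SameBlock.refl (i : Fin n) : SameBlock s i i :=
  ⟨le_rfl, fun _ h h' => absurd h (not_lt.2 h')⟩

theorem SameBlock.trans (h : SameBlock s i j) (h' : SameBlock s j k) : SameBlock s i k :=
  ⟨h.1.trans h'.1, fun l hl hl' => (le_or_gt l j).elim (h.2 l hl) fun hlj => h'.2 l hlj hl'⟩

theorem Link.sameBlock (h : Link s i j) : SameBlock s i j := by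
  obtain ⟨hij, hj⟩ := h
  refine ⟨by omega, fun l hl hl' => ?_⟩
  rwa [show l = j by omega]

theorem SameBlock.exists_link (h : SameBlock s i j) (hij : i ≠ j) :
    ∃ k, Link s i k ∧ SameBlock s k j := by
  obtain ⟨hle, hs⟩ := h
  have hlt : (i : ℕ) < j := lt_of_le_of_ne hle (Fin.val_ne_of_ne hij)
  let k : Fin n := ⟨i + 1, by omega⟩
  have hik : i < k := Fin.lt_def.2 (Nat.lt_succ_self i)
  exact ⟨k, ⟨rfl, hs k hik hlt⟩, hlt, fun l hl => hs l (hik.trans hl)⟩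

theorem SameBlock.map_eq {α : Type*} {f : Fin n → α} (hf : ∀ i j, Link s i j → f i = f j)
    (h : SameBlock s i j) : f i = f j := by
  induction hm : (j : ℕ) - i generalizing i with
  | zero =>
    have hle := h.1
    rw [show i = j by omega]
  | succ m ih =>
    obtain ⟨k, hik, hkj⟩ := h.exists_link (by omega)
    rw [hf i k hik, ih hkj (by have := hik.1; omega)]

theorem jordanMatrix_pow_eq_zero (h : ¬ SameBlock s i j) (m : ℕ) :
    (jordanMatrix d c s ^ m) i j = 0 := by
  induction m generalizing j with
  | zero => exact Matrix.one_apply_ne fun e => h (e ▸ SameBlock.refl i)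
  | succ m ih =>
    rw [pow_succ, mul_jordanMatrix_apply, ih h, zero_mul, zero_add]
    refine Finset.sum_eq_zero fun l _ => ?_
    split_ifs with hl
    · rw [ih fun hil => h (hil.trans hl.sameBlock), zero_mul]
    · rfl

theorem jordanMatrix_pow_apply_self (i : Fin n) (m : ℕ) :
    (jordanMatrix d c s ^ m) i i = d i ^ m := by
  induction m with
  | zero => simp
  | succ m ih =>
    rw [pow_succ, mul_jordanMatrix_apply, ih, pow_succ]
    refine add_eq_left.2 (Finset.sum_eq_zero fun l _ => ?_)
    split_ifs with hl
    · rw [jordanMatrix_pow_eq_zero, zero_mul]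
      intro h
      have := h.1
      have := hl.1
      omega
    · rfl

theorem jordanMatrix_pow_apply_of_link (h : Link s i j) (hd : d i = d j) (m : ℕ) :
    (jordanMatrix d c s ^ m) i j = m * d i ^ (m - 1) * c i := by
  induction m with
  | zero => simp [h.ne]
  | succ m ih =>
    rw [pow_succ, mul_jordanMatrix_apply,
      h.sum_ite_left fun l => (jordanMatrix d c s ^ m) i l * c l, ih,
      jordanMatrix_pow_apply_self, ← hd]
    rcases m with _ | m
    · simp
    · simp only [Nat.add_sub_cancel, pow_succ]
      push_cast
      ring

theorem hasSum_exp_apply {m : Type*} [Fintype m] [DecidableEq m] (M : Matrix m m ℂ) (a b : m) :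
    HasSum (fun k : ℕ => (k.factorial : ℂ)⁻¹ * (M ^ k) a b) (NormedSpace.exp M a b) := by
  let _ : NormedRing (Matrix m m ℂ) := Matrix.linftyOpNormedRing
  let _ : NormedAlgebra ℂ (Matrix m m ℂ) := Matrix.linftyOpNormedAlgebra
  let entry : Matrix m m ℂ →L[ℂ] ℂ := ⟨Matrix.entryLinearMap ℂ ℂ a b, continuous_apply_apply a b⟩
  exact entry.hasSum (NormedSpace.exp_series_hasSum_exp' (𝕂 := ℂ) M)

theorem hasSum_cexp (z : ℂ) :
    HasSum (fun k : ℕ => (k.factorial : ℂ)⁻¹ * z ^ k) (Complex.exp z) := by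
  rw [Complex.exp_eq_exp_ℂ]
  exact NormedSpace.exp_series_hasSum_exp' (𝕂 := ℂ) z

theorem exp_jordanMatrix_eq_zero (h : ¬ SameBlock s i j) :
    NormedSpace.exp (jordanMatrix d c s) i j = 0 := by
  refine (hasSum_exp_apply _ i j).unique ?_
  simp only [jordanMatrix_pow_eq_zero h, mul_zero]
  exact hasSum_zero

theorem exp_jordanMatrix_apply_self (i : Fin n) :
    NormedSpace.exp (jordanMatrix d c s) i i = Complex.exp (d i) := by
  refine (hasSum_exp_apply _ i i).unique ?_
  simp only [jordanMatrix_pow_apply_self]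
  exact hasSum_cexp _

theorem exp_jordanMatrix_apply_of_link (h : Link s i j) (hd : d i = d j) :
    NormedSpace.exp (jordanMatrix d c s) i j = Complex.exp (d i) * c i := by
  refine (hasSum_exp_apply _ i j).unique ?_
  simp only [jordanMatrix_pow_apply_of_link h hd]
  rw [← hasSum_nat_add_iff' 1]
  simp only [Finset.sum_range_one, Nat.cast_zero, zero_mul, mul_zero, sub_zero]
  refine ((hasSum_cexp (d i)).mul_right (c i)).congr_fun fun k => ?_
  have hk : (k : ℂ) + 1 ≠ 0 := Nat.cast_add_one_ne_zero k
  rw [Nat.factorial_succ, Nat.add_sub_cancel]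
  push_cast
  field_simp

theorem det_jordanMatrix : (jordanMatrix d c s).det = ∏ i, d i := by
  rw [Matrix.det_of_isUpperTriangular]
  · simp [jordanMatrix]
  · intro i j hji
    rw [← pow_one (jordanMatrix d c s)]
    exact jordanMatrix_pow_eq_zero (fun h => h.1.not_gt hji) 1

theorem IsJordanBasis.eq_of_link {M P : Matrix (Fin n) (Fin n) ℂ} {μ : Fin n → ℂ}
    (hP : IsJordanBasis M μ s P) (h : Link s i j) : μ i = μ j := by
  obtain ⟨k, hkj, hk⟩ := hP.1 j h.2
  rwa [h.left_unique hkj]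

theorem IsJordanBasis.eigenvalue_ne_zero {M P : Matrix (Fin n) (Fin n) ℂ} {μ : Fin n → ℂ}
    (hP : IsJordanBasis M μ s P) (hM : IsUnit M.det) (i : Fin n) : μ i ≠ 0 := by
  obtain ⟨-, hdet, hPM⟩ := hP
  have hJ : IsUnit (P⁻¹ * M * P).det := by
    simpa only [Matrix.det_mul] using
      ((Matrix.isUnit_nonsing_inv_det _ hdet).mul hM).mul hdet
  rw [hPM, det_jordanMatrix] at hJ
  exact Finset.prod_ne_zero_iff.1 hJ.ne_zero i (Finset.mem_univ i)

end JordanMatrix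

/-! ### Normalization of a Jordan basis -/

section Normalization

variable {n : ℕ} {μ : Fin n → ℂ} {s : Fin n → Bool} {N : Matrix (Fin n) (Fin n) ℂ}

/-- Auxiliary recursion for `normalizer`: its `i`-th row, for `i : ℕ`. -/
def normalizerRow (s : Fin n → Bool) (N : Matrix (Fin n) (Fin n) ℂ) : ℕ → Fin n → ℂ
  | 0 => fun j => if (j : ℕ) = 0 then 1 else 0
  | i + 1 =>
    if ∃ h : i + 1 < n, s ⟨i + 1, h⟩ = true then normalizerRow s N i ᵥ* N
    else fun j => if (j : ℕ) = i + 1 then 1 else 0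

/-- The matrix whose row `i` is `eₚ N ^ (i - p)`, where `p` is the first index of the block of `i`.
Hence multiplying it on the left by the nilpotent Jordan matrix amounts to multiplying it on the
right by `N`. -/
def normalizer (s : Fin n → Bool) (N : Matrix (Fin n) (Fin n) ℂ) : Matrix (Fin n) (Fin n) ℂ :=
  Matrix.of fun i => normalizerRow s N i

theorem normalizer_apply_of_link {i k : Fin n} (h : Link s i k) (j : Fin n) :
    normalizer s N k j = (normalizer s N * N) i j := by
  obtain ⟨k, hk⟩ := k
  obtain ⟨rfl, hs⟩ := h
  rw [normalizer, Matrix.of_apply, normalizerRow, if_pos ⟨hk, hs⟩, Matrix.mul_apply]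
  rfl

theorem normalizer_apply_of_forall_not_link {i : Fin n} (h : ∀ l, ¬ Link s l i) (j : Fin n) :
    normalizer s N i j = (1 : Matrix (Fin n) (Fin n) ℂ) i j := by
  obtain ⟨i, hi⟩ := i
  rw [normalizer, Matrix.of_apply, Matrix.one_apply]
  cases i with
  | zero => simp [normalizerRow, Fin.ext_iff, eq_comm]
  | succ i =>
    have hs : ¬ ∃ hi : i + 1 < n, s ⟨i + 1, hi⟩ = true := fun ⟨_, hs⟩ =>
      h ⟨i, by omega⟩ ⟨rfl, hs⟩
    rw [normalizerRow, if_neg hs]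
    simp [Fin.ext_iff, eq_comm]

theorem normalizer_mul_apply_eq_zero {i j : Fin n}
    (hN : ∀ i j, N i j ≠ 0 → SameBlock s i j ∧ i ≠ j)
    (hi : ∀ k, normalizer s N i k ≠ 0 → SameBlock s i k) (hij : SameBlock s i j → i = j) :
    (normalizer s N * N) i j = 0 := by
  rw [Matrix.mul_apply]
  refine Finset.sum_eq_zero fun k _ => ?_
  by_contra hk
  have hik := hi k (left_ne_zero_of_mul hk)
  obtain ⟨hkj, hne⟩ := hN k j (right_ne_zero_of_mul hk)
  obtain rfl := hij (hik.trans hkj)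
  exact hne (le_antisymm hkj.1 hik.1)

theorem sameBlock_of_normalizer_ne_zero (hN : ∀ i j, N i j ≠ 0 → SameBlock s i j ∧ i ≠ j)
    {i j : Fin n} (hij : normalizer s N i j ≠ 0) : SameBlock s i j := by
  induction hm : (i : ℕ) generalizing i j with
  | zero =>
    rw [normalizer_apply_of_forall_not_link (fun l hl => by have := hl.1; omega)] at hij
    obtain rfl : i = j := by_contra fun h => hij (Matrix.one_apply_ne h)
    exact SameBlock.refl i
  | succ m ih =>
    by_cases h : ∃ l, Link s l i
    · obtain ⟨l, hl⟩ := h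
      rw [normalizer_apply_of_link hl] at hij
      by_contra hnot
      refine hij (normalizer_mul_apply_eq_zero hN
        (fun k hk => ih hk (by have := hl.1; omega)) fun hlj => ?_)
      by_contra hne
      obtain ⟨i', hli', hi'j⟩ := hlj.exists_link hne
      exact hnot (hl.right_unique hli' ▸ hi'j)
    · rw [normalizer_apply_of_forall_not_link (not_exists.1 h)] at hij
      obtain rfl : i = j := by_contra fun h => hij (Matrix.one_apply_ne h)
      exact SameBlock.refl i

theorem normalizer_apply_self (hN : ∀ i j, N i j ≠ 0 → SameBlock s i j ∧ i ≠ j)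
    (hN1 : ∀ i j, Link s i j → N i j = 1) (i : Fin n) : normalizer s N i i = 1 := by
  induction hm : (i : ℕ) generalizing i with
  | zero =>
    rw [normalizer_apply_of_forall_not_link (fun l hl => by have := hl.1; omega),
      Matrix.one_apply_eq]
  | succ m ih =>
    by_cases h : ∃ l, Link s l i
    · obtain ⟨l, hl⟩ := h
      rw [normalizer_apply_of_link hl, Matrix.mul_apply, Finset.sum_eq_single l,
        ih l (by have := hl.1; omega), hN1 l i hl, one_mul]
      · intro k _ hkl
        by_contra hk
        have hlk := (sameBlock_of_normalizer_ne_zero hN (left_ne_zero_of_mul hk)).1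
        obtain ⟨⟨hki, -⟩, hne⟩ := hN k i (right_ne_zero_of_mul hk)
        have := hl.1
        omega
      · simp
    · rw [normalizer_apply_of_forall_not_link (not_exists.1 h), Matrix.one_apply_eq]

theorem jordanMatrix_mul_normalizer (hμ : ∀ i j, Link s i j → μ i = μ j)
    (hN : ∀ i j, N i j ≠ 0 → SameBlock s i j ∧ i ≠ j) :
    jordanMatrix μ (fun _ => 1) s * normalizer s N =
      normalizer s N * (Matrix.diagonal μ + N) := by
  have hsupp : ∀ i j, normalizer s N i j ≠ 0 → SameBlock s i j := fun i j =>
    sameBlock_of_normalizer_ne_zero hN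
  ext i j
  rw [jordanMatrix_mul_apply, Matrix.mul_add, Matrix.add_apply, Matrix.mul_diagonal]
  congr 1
  · by_cases hij : normalizer s N i j = 0
    · simp [hij]
    · rw [(hsupp i j hij).map_eq hμ, mul_comm]
  · simp only [one_mul]
    by_cases h : ∃ k, Link s i k
    · obtain ⟨k, hk⟩ := h
      rw [hk.sum_ite_right fun l => normalizer s N l j, normalizer_apply_of_link hk]
    · rw [normalizer_mul_apply_eq_zero hN (hsupp i)
        fun hij => by_contra fun hne => h ((hij.exists_link hne).imp fun _ => And.left)]
      simp [not_exists.1 h]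

theorem smul_floquetMatrix {T : ℝ} (hT : T ≠ 0) (μ : Fin n → ℂ) (s : Fin n → Bool) :
    (T : ℂ) • floquetMatrix T μ s =
      jordanMatrix (fun i => Complex.log (μ i)) (fun i => (μ i)⁻¹) s := by
  ext i j
  simp only [floquetMatrix, jordanMatrix, floquetExponent, Matrix.smul_apply, Matrix.of_apply,
    smul_eq_mul]
  have hT' : (T : ℂ) ≠ 0 := Complex.ofReal_ne_zero.2 hT
  split_ifs
  · rw [mul_div_cancel₀ _ hT']
  · rw [one_div, mul_inv, mul_inv_cancel_left₀ hT']
  · rw [mul_zero]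

theorem exp_floquetMatrix_sub_diagonal_support {T : ℝ} (hT : T ≠ 0) (hμ0 : ∀ i, μ i ≠ 0)
    {i j : Fin n} (hij : (NormedSpace.exp ((T : ℂ) • floquetMatrix T μ s) -
      Matrix.diagonal μ) i j ≠ 0) : SameBlock s i j ∧ i ≠ j := by
  rw [smul_floquetMatrix hT, Matrix.sub_apply] at hij
  have hne : i ≠ j := by
    rintro rfl
    simp [exp_jordanMatrix_apply_self, Complex.exp_log (hμ0 i)] at hij
  rw [Matrix.diagonal_apply_ne _ hne, sub_zero] at hij
  exact ⟨not_imp_comm.1 exp_jordanMatrix_eq_zero hij, hne⟩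

theorem exp_floquetMatrix_apply_of_link {T : ℝ} (hT : T ≠ 0) (hμ0 : ∀ i, μ i ≠ 0) {i j : Fin n}
    (h : Link s i j) (hμ : μ i = μ j) :
    NormedSpace.exp ((T : ℂ) • floquetMatrix T μ s) i j = 1 := by
  rw [smul_floquetMatrix hT, exp_jordanMatrix_apply_of_link h (by rw [hμ]),
    Complex.exp_log (hμ0 i), mul_inv_cancel₀ (hμ0 i)]

theorem exists_isNormalizedBasis {T : ℝ} (hT : T ≠ 0) {M P : Matrix (Fin n) (Fin n) ℂ}
    (hP : IsJordanBasis M μ s P) (hμ0 : ∀ i, μ i ≠ 0) :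
    ∃ C : Matrix (Fin n) (Fin n) ℂ, (∀ i, C i i = 1) ∧
      (∀ i j, i ≠ j → C i j ≠ 0 → SameBlock s i j ∧
        ∃ k : Fin n, SameBlock s k j ∧ (k : ℕ) + 2 ≤ j) ∧
      IsNormalizedBasis T M μ s (P * C) := by
  let N := NormedSpace.exp ((T : ℂ) • floquetMatrix T μ s) - Matrix.diagonal μ
  have hN : ∀ i j, N i j ≠ 0 → SameBlock s i j ∧ i ≠ j := fun i j =>
    exp_floquetMatrix_sub_diagonal_support hT hμ0
  have hN1 : ∀ i j, Link s i j → N i j = 1 := fun i j h => by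
    change (_ - Matrix.diagonal μ) i j = 1
    rw [Matrix.sub_apply, exp_floquetMatrix_apply_of_link hT hμ0 h (hP.eq_of_link h),
      Matrix.diagonal_apply_ne _ h.ne, sub_zero]
  have hdiag := normalizer_apply_self hN hN1
  refine ⟨normalizer s N, hdiag, fun i j hij hC => ?_, ?_, ?_⟩
  · have hblock := sameBlock_of_normalizer_ne_zero hN hC
    obtain ⟨k, hk⟩ : ∃ k, Link s k i := by
      by_contra h
      exact hC <| by
        rw [normalizer_apply_of_forall_not_link (not_exists.1 h), Matrix.one_apply_ne hij]
    refine ⟨hblock, k, hk.sameBlock.trans hblock, ?_⟩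
    have := hblock.1
    have := hk.1
    omega
  · have hdet : (normalizer s N).det = 1 := by
      have htri : (normalizer s N).IsUpperTriangular := fun i j hji => by_contra fun h =>
        (sameBlock_of_normalizer_ne_zero hN h).1.not_gt hji
      simp [Matrix.det_of_isUpperTriangular htri, hdiag]
    simpa [Matrix.det_mul, hdet] using hP.2.1
  · rw [← Matrix.mul_assoc, (nonsing_inv_mul_mul_eq_iff hP.2.1).1 hP.2.2, Matrix.mul_assoc,
      jordanMatrix_mul_normalizer (fun _ _ => hP.eq_of_link) hN, add_sub_cancel, Matrix.mul_assoc]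

end Normalization

/-! ### Floquet factorization -/

section Exponential

variable {ι : Type*} [Fintype ι] [DecidableEq ι] (M : Matrix ι ι ℂ)

theorem commute_exp_smul (t : ℂ) : Commute M (NormedSpace.exp (t • M)) := by
  let _ : NormedRing (Matrix ι ι ℂ) := Matrix.linftyOpNormedRing
  let _ : NormedAlgebra ℚ (Matrix ι ι ℂ) := Matrix.linftyOpNormedAlgebra
  exact ((Commute.refl M).smul_right t).exp_right

theorem exp_add_smul (t u : ℂ) :
    NormedSpace.exp ((t + u) • M) = NormedSpace.exp (t • M) * NormedSpace.exp (u • M) := by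
  rw [add_smul, Matrix.exp_add_of_commute]
  exact ((Commute.refl M).smul_left t).smul_right u

theorem exp_smul_mul_exp_smul_neg (t : ℂ) :
    NormedSpace.exp (t • M) * NormedSpace.exp (t • -M) = 1 := by
  rw [smul_neg, ← Matrix.exp_add_of_commute _ _ (Commute.refl (t • M)).neg_right,
    add_neg_cancel, NormedSpace.exp_zero]

end Exponential

section Transition

variable {n : ℕ} {A Φ : ℝ → Matrix (Fin n) (Fin n) ℂ}

theorem isTransitionMatrix_iff_isMatPrimitive :
    IsTransitionMatrix A Φ ↔ Φ 0 = 1 ∧ IsMatPrimitive Φ fun t => A t * Φ t := by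
  simp only [IsTransitionMatrix, isSolution_iff_isPrimitive]
  exact and_congr_right fun _ => forall_comm

variable (hA : ∀ i j, LocallyIntegrable fun t => A t i j)
include hA

namespace IsTransitionMatrix

theorem isUnit_det (hΦ : IsTransitionMatrix A Φ) (t : ℝ) : IsUnit (Φ t).det :=
  have ⟨hΦ0, hΦ'⟩ := isTransitionMatrix_iff_isMatPrimitive.1 hΦ
  (isMatPrimitive_inv_fundamental_matrix hA hΦ0 hΦ').1 t

theorem isMatPrimitive_inv (hΦ : IsTransitionMatrix A Φ) :
    IsMatPrimitive (fun t => (Φ t)⁻¹) fun t => -((Φ t)⁻¹ * A t) :=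
  have ⟨hΦ0, hΦ'⟩ := isTransitionMatrix_iff_isMatPrimitive.1 hΦ
  (isMatPrimitive_inv_fundamental_matrix hA hΦ0 hΦ').2

theorem eq_mul_apply_zero (hΦ : IsTransitionMatrix A Φ) {m : Type*}
    {X : ℝ → Matrix (Fin n) m ℂ} (hX : IsMatPrimitive X fun t => A t * X t) (t : ℝ) :
    X t = Φ t * X 0 := by
  have hconst : IsMatPrimitive (fun t => (Φ t)⁻¹ * X t) fun _ => 0 :=
    ((hΦ.isMatPrimitive_inv hA).mul hX).congr fun t => by simp [Matrix.mul_assoc]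
  have h := hconst.eq_of_deriv_zero t 0
  rw [hΦ.1, inv_one, Matrix.one_mul] at h
  rw [← h, Matrix.mul_nonsing_inv_cancel_left _ _ (hΦ.isUnit_det hA t)]

theorem apply_add_period (hΦ : IsTransitionMatrix A Φ) {T : ℝ} (hper : Function.Periodic A T)
    (t : ℝ) : Φ (t + T) = Φ t * Φ T := by
  have hshift : IsMatPrimitive (fun t => Φ (t + T)) fun t => A t * Φ (t + T) := fun i j =>
    (((isTransitionMatrix_iff_isMatPrimitive.1 hΦ).2 i j).comp_add_right T).congr fun t => by
      change (A (t + T) * Φ (t + T)) i j = _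
      rw [hper t]
  simpa only [zero_add] using hΦ.eq_mul_apply_zero hA hshift t

end IsTransitionMatrix

theorem existsUnique_isTransitionMatrix : ∃! Φ, IsTransitionMatrix A Φ := by
  obtain ⟨Φ, hΦ⟩ := exists_fundamental_matrix hA
  rw [← isTransitionMatrix_iff_isMatPrimitive] at hΦ
  refine ⟨Φ, hΦ, fun X hX => funext fun t => ?_⟩
  rw [hΦ.eq_mul_apply_zero hA (isTransitionMatrix_iff_isMatPrimitive.1 hX).2, hX.1, Matrix.mul_one]

end Transition

/-- The factor `W(t) = Φ(t) Ψ e^{-tΛ}` of the Floquet factorization `Φ(t) = W(t) e^{tΛ} Ψ⁻¹`. -/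
noncomputable def floquetFactor {ι : Type*} [Fintype ι] [DecidableEq ι] (Φ : ℝ → Matrix ι ι ℂ)
    (Ψ Λ : Matrix ι ι ℂ) (t : ℝ) : Matrix ι ι ℂ :=
  Φ t * Ψ * NormedSpace.exp ((t : ℂ) • -Λ)

theorem floquetFactor_mul_exp_smul {ι : Type*} [Fintype ι] [DecidableEq ι] (Φ : ℝ → Matrix ι ι ℂ)
    (Ψ Λ : Matrix ι ι ℂ) (t : ℝ) :
    floquetFactor Φ Ψ Λ t * NormedSpace.exp ((t : ℂ) • Λ) = Φ t * Ψ := by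
  rw [floquetFactor, Matrix.mul_assoc, mul_eq_one_comm.1 (exp_smul_mul_exp_smul_neg Λ t),
    Matrix.mul_one]

section FloquetFactor

variable {n : ℕ} {A Φ : ℝ → Matrix (Fin n) (Fin n) ℂ} {Ψ Λ : Matrix (Fin n) (Fin n) ℂ}

theorem floquetFactor_zero (hΦ : IsTransitionMatrix A Φ) : floquetFactor Φ Ψ Λ 0 = Ψ := by
  simp [floquetFactor, hΦ.1]

variable (Ψ Λ) in
theorem isMatPrimitive_floquetFactor (hΦ : IsTransitionMatrix A Φ) :
    IsMatPrimitive (floquetFactor Φ Ψ Λ)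
      fun t => A t * floquetFactor Φ Ψ Λ t - floquetFactor Φ Ψ Λ t * Λ := by
  refine (((isTransitionMatrix_iff_isMatPrimitive.1 hΦ).2.mul (.const Ψ)).mul
    (isMatPrimitive_exp_smul (-Λ))).congr fun t => ?_
  rw [(commute_exp_smul (-Λ) t).eq]
  simp only [floquetFactor]
  noncomm_ring

variable (hA : ∀ i j, LocallyIntegrable fun t => A t i j)
include hA

theorem eq_floquetFactor_iff (hΦ : IsTransitionMatrix A Φ)
    {W : ℝ → Matrix (Fin n) (Fin n) ℂ} :
    W = floquetFactor Φ Ψ Λ ↔ W 0 = Ψ ∧ IsMatPrimitive W fun t => A t * W t - W t * Λ := by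
  constructor
  · rintro rfl
    exact ⟨floquetFactor_zero hΦ, isMatPrimitive_floquetFactor Ψ Λ hΦ⟩
  · rintro ⟨hW0, hW⟩
    have hX : IsMatPrimitive (fun t : ℝ => W t * NormedSpace.exp ((t : ℂ) • Λ))
        fun t => A t * (W t * NormedSpace.exp ((t : ℂ) • Λ)) :=
      (hW.mul (isMatPrimitive_exp_smul Λ)).congr fun t => by noncomm_ring
    funext t
    rw [floquetFactor, ← Matrix.mul_one (W t), ← exp_smul_mul_exp_smul_neg Λ t,
      ← Matrix.mul_assoc, hΦ.eq_mul_apply_zero hA hX t]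
    simp [hW0]

variable (Λ) in
theorem isUnit_det_floquetFactor (hΦ : IsTransitionMatrix A Φ) (hΨ : IsUnit Ψ.det) (t : ℝ) :
    IsUnit (floquetFactor Φ Ψ Λ t).det := by
  rw [floquetFactor, Matrix.det_mul, Matrix.det_mul]
  exact ((hΦ.isUnit_det hA t).mul hΨ).mul
    (Matrix.isUnit_det_of_left_inverse (exp_smul_mul_exp_smul_neg Λ t))

variable (Ψ Λ) in
theorem isMatPrimitive_inv_floquetFactor (hΦ : IsTransitionMatrix A Φ) :
    IsMatPrimitive (fun t => (floquetFactor Φ Ψ Λ t)⁻¹)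
      fun t => -((floquetFactor Φ Ψ Λ t)⁻¹ * A t) + Λ * (floquetFactor Φ Ψ Λ t)⁻¹ := by
  have hinv : ∀ t, (floquetFactor Φ Ψ Λ t)⁻¹ =
      NormedSpace.exp ((t : ℂ) • Λ) * (Ψ⁻¹ * (Φ t)⁻¹) := fun t => by
    rw [floquetFactor, Matrix.mul_inv_rev, Matrix.mul_inv_rev,
      Matrix.inv_eq_left_inv (exp_smul_mul_exp_smul_neg Λ t)]
  simp only [hinv]
  refine ((isMatPrimitive_exp_smul Λ).mul
    ((IsMatPrimitive.const Ψ⁻¹).mul (hΦ.isMatPrimitive_inv hA))).congr fun t => ?_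
  noncomm_ring

theorem periodic_floquetFactor (hΦ : IsTransitionMatrix A Φ) {T : ℝ}
    (hper : Function.Periodic A T) (hΨ : Φ T * Ψ = Ψ * NormedSpace.exp ((T : ℂ) • Λ)) :
    Function.Periodic (floquetFactor Φ Ψ Λ) T := fun t => by
  have hadd : NormedSpace.exp (((t + T : ℝ) : ℂ) • -Λ) =
      NormedSpace.exp ((T : ℂ) • -Λ) * NormedSpace.exp ((t : ℂ) • -Λ) := by
    rw [Complex.ofReal_add, add_comm, exp_add_smul]
  calc floquetFactor Φ Ψ Λ (t + T)
      = Φ t * (Φ T * Ψ) * (NormedSpace.exp ((T : ℂ) • -Λ) * NormedSpace.exp ((t : ℂ) • -Λ)) := by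
        rw [floquetFactor, hadd, hΦ.apply_add_period hA hper, Matrix.mul_assoc (Φ t)]
    _ = Φ t * Ψ * (NormedSpace.exp ((T : ℂ) • Λ) * NormedSpace.exp ((T : ℂ) • -Λ)) *
          NormedSpace.exp ((t : ℂ) • -Λ) := by
        rw [hΨ]
        simp only [Matrix.mul_assoc]
    _ = floquetFactor Φ Ψ Λ t := by
        rw [exp_smul_mul_exp_smul_neg, Matrix.mul_one, floquetFactor]

end FloquetFactor

section FloquetSolution

variable {n : ℕ} {T : ℝ} {A Φ : ℝ → Matrix (Fin n) (Fin n) ℂ} {μ : Fin n → ℂ} {s : Fin n → Bool}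
  {Ψ : Matrix (Fin n) (Fin n) ℂ}

theorem isFloquetSolution_iff_isMatPrimitive {v : Fin n → ℝ → Fin n → ℂ}
    {W : ℝ → Matrix (Fin n) (Fin n) ℂ} (hW : ∀ t i j, W t i j = v j t i) :
    IsFloquetSolution T A μ s Ψ v ↔
      W 0 = Ψ ∧ IsMatPrimitive W fun t => A t * W t - W t * floquetMatrix T μ s := by
  have hrhs : ∀ j t i, (A t *ᵥ v j t - floquetExponent T μ j • v j t
        - ∑ l, if Link s l j then (1 / (T * μ l)) • v l t else 0) i =
      (A t * W t - W t * floquetMatrix T μ s) i j := fun j t i => by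
    rw [Matrix.sub_apply, floquetMatrix, mul_jordanMatrix_apply, Matrix.mul_apply, Pi.sub_apply,
      Pi.sub_apply, Finset.sum_apply, Matrix.mulVec, dotProduct, sub_sub]
    congr 2
    · simp only [hW]
    · rw [Pi.smul_apply, smul_eq_mul, hW, mul_comm]
    · refine Finset.sum_congr rfl fun l _ => ?_
      split_ifs <;> simp [hW, mul_comm]
  simp only [IsFloquetSolution, IsMatPrimitive, IsPrimitive, hasDerivAt_pi, hrhs,
    Filter.eventually_all, ← hW, forall_and, funext_iff, ← Matrix.ext_iff]
  exact and_congr forall_comm (and_congr forall_comm forall_comm)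

theorem isFloquetSolution_iff_eq_floquetFactor (hA : ∀ i j, LocallyIntegrable fun t => A t i j)
    (hΦ : IsTransitionMatrix A Φ) {v : Fin n → ℝ → Fin n → ℂ}
    {W : ℝ → Matrix (Fin n) (Fin n) ℂ} (hW : ∀ t i j, W t i j = v j t i) :
    IsFloquetSolution T A μ s Ψ v ↔ W = floquetFactor Φ Ψ (floquetMatrix T μ s) :=
  (isFloquetSolution_iff_isMatPrimitive hW).trans (eq_floquetFactor_iff hA hΦ).symm

theorem existsUnique_isFloquetSolution (hA : ∀ i j, LocallyIntegrable fun t => A t i j) :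
    ∃! v : Fin n → ℝ → Fin n → ℂ, IsFloquetSolution T A μ s Ψ v := by
  obtain ⟨Φ, hΦ, -⟩ := existsUnique_isTransitionMatrix hA
  refine ⟨fun j t i => floquetFactor Φ Ψ (floquetMatrix T μ s) t i j,
    (isFloquetSolution_iff_eq_floquetFactor hA hΦ fun _ _ _ => rfl).2 rfl, fun v hv => ?_⟩
  have hW := (isFloquetSolution_iff_eq_floquetFactor hA hΦ
    (W := fun t => Matrix.of fun i j => v j t i) fun _ _ _ => rfl).1 hv
  rw [← hW]
  rfl

end FloquetSolution

theorem isSolution_iff_isSolution_inv_mulVec {n : ℕ} {A W : ℝ → Matrix (Fin n) (Fin n) ℂ}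
    {Λ : Matrix (Fin n) (Fin n) ℂ} (hW : IsMatPrimitive W fun t => A t * W t - W t * Λ)
    (hWinv : IsMatPrimitive (fun t => (W t)⁻¹) fun t => -((W t)⁻¹ * A t) + Λ * (W t)⁻¹)
    (hdet : ∀ t, IsUnit (W t).det) (x : ℝ → Fin n → ℂ) :
    IsSolution A x ↔ IsSolution (fun _ => Λ) (fun t => (W t)⁻¹ *ᵥ x t) := by
  simp only [isSolution_iff_isPrimitive]
  constructor
  · intro h i
    refine (hWinv.mulVec h i).congr fun t => ?_
    simp [Matrix.add_mulVec, Matrix.neg_mulVec]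
  · intro h i
    have hx : ∀ t, W t *ᵥ ((W t)⁻¹ *ᵥ x t) = x t := fun t => by
      rw [Matrix.mulVec_mulVec, Matrix.mul_nonsing_inv _ (hdet t), Matrix.one_mulVec]
    have hWx := hW.mulVec h i
    simp only [hx] at hWx
    refine hWx.congr fun t => ?_
    rw [Matrix.sub_mulVec, ← Matrix.mulVec_mulVec, ← Matrix.mulVec_mulVec, hx, sub_add_cancel]

/-! ### Phasors -/

section Phasor

variable {T : ℝ}

/-- The imaginary frequency `jω = 2πj/T` at which `T`-periodic signals are expanded. -/
noncomputable def angularFrequency (T : ℝ) : ℂ :=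
  Complex.I * (2 * Real.pi / T)

theorem angularFrequency_ne_zero (hT : T ≠ 0) : angularFrequency T ≠ 0 := by
  simp [angularFrequency, hT, Real.pi_ne_zero]

theorem fourier_eq_exp (k : ℤ) (t : ℝ) :
    fourier k (t : AddCircle T) = Complex.exp (angularFrequency T * k * t) := by
  rw [fourier_coe_apply, angularFrequency]
  ring_nf

theorem continuous_fourier_coe (k : ℤ) : Continuous fun t : ℝ => fourier k (t : AddCircle T) :=
  (map_continuous _).comp continuous_quotient_mk'

theorem phasor_eq_integral_fourier (a : ℝ → ℂ) (k : ℤ) :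
    phasor T a k = 1 / T * ∫ t in (0 : ℝ)..T, a t * fourier (-k) (t : AddCircle T) := by
  simp only [phasor, fourier_eq_exp, angularFrequency]
  push_cast
  ring_nf

theorem phasor_eq_fourierCoeffOn (hT : 0 < T) (a : ℝ → ℂ) (k : ℤ) :
    phasor T a k = fourierCoeffOn hT a k := by
  rw [fourierCoeffOn_eq_integral, phasor_eq_integral_fourier, sub_zero, Complex.real_smul]
  simp [mul_comm]

theorem intervalIntegrable_mul_fourier {a : ℝ → ℂ} (ha : IntervalIntegrable a volume 0 T)
    (k : ℤ) : IntervalIntegrable (fun t => a t * fourier k (t : AddCircle T)) volume 0 T :=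
  ha.mul_continuousOn (continuous_fourier_coe k).continuousOn

theorem phasor_add {a b : ℝ → ℂ} (ha : IntervalIntegrable a volume 0 T)
    (hb : IntervalIntegrable b volume 0 T) (k : ℤ) :
    phasor T (fun t => a t + b t) k = phasor T a k + phasor T b k := by
  simp only [phasor_eq_integral_fourier, add_mul]
  rw [intervalIntegral.integral_add (intervalIntegrable_mul_fourier ha _)
    (intervalIntegrable_mul_fourier hb _), mul_add]

theorem phasor_sum {ι : Type*} (s : Finset ι) {a : ι → ℝ → ℂ}
    (ha : ∀ i ∈ s, IntervalIntegrable (a i) volume 0 T) (k : ℤ) :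
    phasor T (fun t => ∑ i ∈ s, a i t) k = ∑ i ∈ s, phasor T (a i) k := by
  simp only [phasor_eq_integral_fourier, Finset.sum_mul, ← Finset.mul_sum]
  rw [intervalIntegral.integral_finsetSum fun i hi => intervalIntegrable_mul_fourier (ha i hi) _]

theorem summable_sq_phasor (hT : 0 < T) {a : ℝ → ℂ}
    (ha : MemLp a 2 (volume.restrict (Set.Icc 0 T))) :
    Summable fun k => ‖phasor T a k‖ ^ 2 := by
  simp only [phasor_eq_fourierCoeffOn hT]
  exact (hasSum_sq_fourierCoeffOn hT
    (ha.mono_measure (Measure.restrict_mono Set.Ioc_subset_Icc_self le_rfl))).summable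

theorem isPrimitive_fourier (k : ℤ) :
    IsPrimitive (fun t => fourier k (t : AddCircle T))
      fun t => angularFrequency T * k * fourier k (t : AddCircle T) := by
  refine .of_hasDerivAt (fun t => ?_) (continuous_const.mul (continuous_fourier_coe k))
  convert hasDerivAt_fourier T k t using 2
  rw [angularFrequency]
  ring

theorem IsPrimitive.phasor_deriv {f g : ℝ → ℂ} (h : IsPrimitive f g) (hper : f T = f 0) (k : ℤ) :
    phasor T g k = angularFrequency T * k * phasor T f k := by
  have hg := intervalIntegrable_of_locallyIntegrable h.locallyIntegrable 0 T
  have hf : IntervalIntegrable (fun t => f t * fourier (-k) (t : AddCircle T)) volume 0 T :=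
    intervalIntegrable_mul_fourier (h.continuous.intervalIntegrable 0 T) _
  have hprod : IsPrimitive (fun t => f t * fourier (-k) (t : AddCircle T)) fun t =>
      g t * fourier (-k) (t : AddCircle T) -
        angularFrequency T * k * (f t * fourier (-k) (t : AddCircle T)) := by
    refine (h.mul (isPrimitive_fourier (-k))).congr fun t => ?_
    push_cast
    ring
  have hboundary := hprod.eq_add_integral 0 T
  rw [intervalIntegral.integral_sub (intervalIntegrable_mul_fourier hg _) (hf.const_mul _),
    intervalIntegral.integral_const_mul, AddCircle.coe_period, ← QuotientAddGroup.mk_zero,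
    hper, left_eq_add, sub_eq_zero] at hboundary
  rw [phasor_eq_integral_fourier, phasor_eq_integral_fourier, hboundary]
  ring

theorem phasor_const (hT : T ≠ 0) (c : ℂ) (k : ℤ) :
    phasor T (fun _ => c) k = if k = 0 then c else 0 := by
  split_ifs with hk
  · simp [phasor, hk, hT]
  · have hderiv := (IsPrimitive.const c).phasor_deriv (T := T) rfl k
    have hzero : phasor T (fun _ => 0) k = 0 := by simp [phasor]
    rw [hzero, eq_comm, mul_eq_zero] at hderiv
    exact hderiv.resolve_left
      (mul_ne_zero (angularFrequency_ne_zero hT) (Int.cast_ne_zero.2 hk))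

theorem IsPrimitive.summable_sq_mul_phasor (hT : 0 < T) {f g : ℝ → ℂ} (h : IsPrimitive f g)
    (hg : MemLp g 2 (volume.restrict (Set.Icc 0 T))) (hper : f T = f 0) :
    Summable fun k : ℤ => ‖(k : ℂ) * phasor T f k‖ ^ 2 := by
  have hω := angularFrequency_ne_zero hT.ne'
  refine ((summable_sq_phasor hT hg).mul_left (‖(angularFrequency T)⁻¹‖ ^ 2)).congr fun k => ?_
  rw [h.phasor_deriv hper, ← mul_pow, ← norm_mul]
  field_simp

/-- AM-GM: `2 |c k| ≤ |k c k| ^ 2 + 1 / k ^ 2`. -/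
theorem summable_norm_of_summable_sq_mul {c : ℤ → ℂ}
    (hc : Summable fun k : ℤ => ‖(k : ℂ) * c k‖ ^ 2) : Summable fun k => ‖c k‖ := by
  have hinv : Summable fun k : ℤ => 1 / (k : ℝ) ^ 2 := Real.summable_one_div_int_pow.2 one_lt_two
  refine .of_norm_bounded_eventually (hc.add hinv) ?_
  filter_upwards [(Set.finite_singleton (0 : ℤ)).compl_mem_cofinite] with k hk
  have hk' : |(k : ℝ)| ≠ 0 := abs_ne_zero.2 (Int.cast_ne_zero.2 hk)
  have hamgm := two_mul_le_add_sq (|(k : ℝ)| * ‖c k‖) |(k : ℝ)|⁻¹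
  rw [norm_norm, norm_mul, Complex.norm_intCast, one_div, ← sq_abs (k : ℝ), ← inv_pow]
  have hcancel : 2 * (|(k : ℝ)| * ‖c k‖) * |(k : ℝ)|⁻¹ = 2 * ‖c k‖ := by field_simp
  linarith [norm_nonneg (c k)]

theorem hasSum_phasor_mul_fourier (hT : 0 < T) {f : ℝ → ℂ} (hf : Continuous f)
    (hper : Function.Periodic f T) (hs : Summable fun k => ‖phasor T f k‖) (t : ℝ) :
    HasSum (fun m : ℤ => phasor T f m * fourier m (t : AddCircle T)) (f t) := by
  have : Fact (0 < T) := ⟨hT⟩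
  let F : C(AddCircle T, ℂ) := ⟨hper.lift, continuous_coinduced_dom.2 hf⟩
  have hcoeff : fourierCoeff F = phasor T f := by
    funext m
    rw [fourierCoeff_eq_intervalIntegral _ _ 0, phasor_eq_integral_fourier, Complex.real_smul,
      zero_add]
    simp [F, mul_comm]
  have hF : F t = f t := hper.lift_coe t
  have hsum := has_pointwise_sum_fourier_series_of_summable (f := F) (hcoeff ▸ hs.of_norm) t
  simpa only [hcoeff, smul_eq_mul, hF] using hsum

theorem hasSum_phasor_mul (hT : 0 < T) {a f : ℝ → ℂ} (ha : IntervalIntegrable a volume 0 T)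
    (hf : Continuous f) (hper : Function.Periodic f T)
    (hs : Summable fun k => ‖phasor T f k‖) (k : ℤ) :
    HasSum (fun m : ℤ => phasor T a (k - m) * phasor T f m) (phasor T (fun t => a t * f t) k) := by
  let F : ℤ → ℝ → ℂ := fun m t =>
    phasor T f m * (a t * fourier (-(k - m)) (t : AddCircle T))
  have hint : ∀ m, Integrable (F m) (volume.restrict (Set.Ioc 0 T)) := fun m =>
    (intervalIntegrable_mul_fourier ha _).1.const_mul _
  have hnorm : ∀ m t, ‖F m t‖ = ‖phasor T f m‖ * ‖a t‖ := fun m t => by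
    simp only [F, norm_mul, fourier_apply, Circle.norm_coe, mul_one]
  have hsummable : Summable fun m => ∫ t in Set.Ioc 0 T, ‖F m t‖ := by
    simp only [hnorm, integral_const_mul]
    exact hs.mul_right _
  have hseries : ∀ t, ∑' m, F m t = a t * f t * fourier (-k) (t : AddCircle T) := by
    intro t
    rw [mul_right_comm]
    refine HasSum.tsum_eq (.congr_fun ((hasSum_phasor_mul_fourier hT hf hper hs t).mul_left
      (a t * fourier (-k) (t : AddCircle T))) fun m => ?_)
    simp only [F, show -(k - m) = -k + m by ring, fourier_add]
    ring
  have hsum := (hasSum_integral_of_summable_integral_norm hint hsummable).mul_left (1 / (T : ℂ))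
  simp only [hseries, F, integral_const_mul] at hsum
  rw [phasor_eq_integral_fourier, intervalIntegral.integral_of_le hT.le]
  refine hsum.congr_fun fun m => ?_
  rw [phasor_eq_integral_fourier a, intervalIntegral.integral_of_le hT.le]
  ring

end Phasor

/-! ### Infinite matrices on `ℓ²` -/

theorem memℓp_two_iff {κ : Type*} {x : κ → ℂ} : Memℓp x 2 ↔ Summable fun q => ‖x q‖ ^ 2 := by
  rw [memℓp_gen_iff (by norm_num)]
  norm_num

theorem lp_two_norm_sq {κ : Type*} (x : lp (fun _ : κ => ℂ) 2) : ‖x‖ ^ 2 = ∑' q, ‖x q‖ ^ 2 := by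
  simpa using lp.norm_rpow_eq_tsum (p := 2) (by norm_num) x

theorem memℓp_two_of_summable_norm {κ : Type*} {a : κ → ℂ} (ha : Summable fun q => ‖a q‖) :
    Memℓp a 2 :=
  (memℓp_gen (p := 1) (by simpa using ha)).of_exponent_ge one_le_two

theorem norm_mul_norm_le_half (z w : ℂ) : ‖z‖ * ‖w‖ ≤ (‖z‖ ^ 2 + ‖w‖ ^ 2) / 2 := by
  linarith [two_mul_le_add_sq ‖z‖ ‖w‖]

theorem summable_norm_mul_norm {κ : Type*} {a x : κ → ℂ} (ha : Memℓp a 2) (hx : Memℓp x 2) :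
    Summable fun q => ‖a q‖ * ‖x q‖ :=
  .of_nonneg_of_le (fun _ => by positivity) (fun q => norm_mul_norm_le_half (a q) (x q))
    (((memℓp_two_iff.1 ha).add (memℓp_two_iff.1 hx)).div_const 2)

theorem summable_mul_of_memℓp_two {κ : Type*} {a x : κ → ℂ} (ha : Memℓp a 2) (hx : Memℓp x 2) :
    Summable fun q => a q * x q :=
  .of_norm (by simpa only [norm_mul] using summable_norm_mul_norm ha hx)

theorem sq_tsum_mul_le_tsum_mul_tsum_mul_sq {κ : Type*} {k x : κ → ℝ} (hk_nonneg : ∀ q, 0 ≤ k q)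
    (hk : Summable k) (hkx : Summable fun q => k q * x q)
    (hkx2 : Summable fun q => k q * x q ^ 2) :
    (∑' q, k q * x q) ^ 2 ≤ (∑' q, k q) * ∑' q, k q * x q ^ 2 := by
  have hquad : ∀ t : ℝ, 0 ≤ (∑' q, k q) * (t * t) + (-2 * ∑' q, k q * x q) * t +
      ∑' q, k q * x q ^ 2 := by
    intro t
    refine HasSum.nonneg (g := fun q => k q * (t - x q) ^ 2)
      (fun q => mul_nonneg (hk_nonneg q) (sq_nonneg _)) (.congr_fun
        (((hk.hasSum.mul_right (t * t)).add ((hkx.hasSum.mul_left (-2)).mul_right t)).add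
          hkx2.hasSum) fun q => ?_)
    ring
  have hdiscrim := discrim_le_zero hquad
  rw [discrim] at hdiscrim
  linarith

section Schur

variable {κ : Type*}

/-- The hypotheses of the Schur test: the absolute row sums and the absolute column sums of the
infinite matrix `M` are at most `C`. -/
structure SchurBound (M : Matrix κ κ ℂ) (C : ℝ) : Prop where
  bound_nonneg : 0 ≤ C
  summable_row : ∀ p, Summable fun q => ‖M p q‖
  tsum_row_le : ∀ p, ∑' q, ‖M p q‖ ≤ C
  summable_col : ∀ q, Summable fun p => ‖M p q‖
  tsum_col_le : ∀ q, ∑' p, ‖M p q‖ ≤ C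

namespace SchurBound

variable {M : Matrix κ κ ℂ} {C : ℝ} {x : κ → ℂ}

theorem memℓp_row (h : SchurBound M C) (p : κ) : Memℓp (M p) 2 :=
  memℓp_two_of_summable_norm (h.summable_row p)

theorem tsum_col_mul_sq_le (h : SchurBound M C) (q : κ) :
    ∑' p, ‖M p q‖ * ‖x q‖ ^ 2 ≤ C * ‖x q‖ ^ 2 := by
  rw [tsum_mul_right]
  exact mul_le_mul_of_nonneg_right (h.tsum_col_le q) (sq_nonneg _)

theorem summable_prod_mul_sq (h : SchurBound M C) (hx : Memℓp x 2) :
    Summable fun z : κ × κ => ‖M z.2 z.1‖ * ‖x z.1‖ ^ 2 := by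
  refine (summable_prod_of_nonneg fun z => by dsimp only [Pi.zero_apply]; positivity).2
    ⟨fun q => (h.summable_col q).mul_right (‖x q‖ ^ 2), ?_⟩
  exact .of_nonneg_of_le (fun q => tsum_nonneg fun _ => by positivity)
    (fun q => h.tsum_col_mul_sq_le q) ((memℓp_two_iff.1 hx).mul_left C)

theorem sq_tsum_row_le (h : SchurBound M C) (hx : Memℓp x 2) (p : κ) :
    (∑' q, ‖M p q‖ * ‖x q‖) ^ 2 ≤ C * ∑' q, ‖M p q‖ * ‖x q‖ ^ 2 := by
  refine (sq_tsum_mul_le_tsum_mul_tsum_mul_sq (fun q => norm_nonneg _) (h.summable_row p)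
    (summable_norm_mul_norm (h.memℓp_row p) hx)
    ((h.summable_prod_mul_sq hx).prod_symm.prod_factor p)).trans ?_
  exact mul_le_mul_of_nonneg_right (h.tsum_row_le p) (tsum_nonneg fun q => by positivity)

theorem summable_sq_tsum_row (h : SchurBound M C) (hx : Memℓp x 2) :
    Summable fun p => (∑' q, ‖M p q‖ * ‖x q‖) ^ 2 :=
  .of_nonneg_of_le (fun _ => sq_nonneg _) (h.sq_tsum_row_le hx)
    ((h.summable_prod_mul_sq hx).prod_symm.prod.mul_left C)

theorem tsum_sq_tsum_row_le (h : SchurBound M C) (hx : Memℓp x 2) :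
    ∑' p, (∑' q, ‖M p q‖ * ‖x q‖) ^ 2 ≤ C ^ 2 * ∑' q, ‖x q‖ ^ 2 := by
  have hprod := h.summable_prod_mul_sq hx
  calc ∑' p, (∑' q, ‖M p q‖ * ‖x q‖) ^ 2 ≤ ∑' p, C * ∑' q, ‖M p q‖ * ‖x q‖ ^ 2 :=
        (h.summable_sq_tsum_row hx).tsum_le_tsum (h.sq_tsum_row_le hx)
          (hprod.prod_symm.prod.mul_left C)
    _ = C * ∑' q, ∑' p, ‖M p q‖ * ‖x q‖ ^ 2 := by
        rw [tsum_mul_left, Summable.tsum_comm (f := fun q p => ‖M p q‖ * ‖x q‖ ^ 2) hprod]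
    _ ≤ C * ∑' q, C * ‖x q‖ ^ 2 :=
        mul_le_mul_of_nonneg_left (hprod.prod.tsum_le_tsum (fun q => h.tsum_col_mul_sq_le q)
          ((memℓp_two_iff.1 hx).mul_left C)) h.bound_nonneg
    _ = C ^ 2 * ∑' q, ‖x q‖ ^ 2 := by
        rw [tsum_mul_left]
        ring

theorem sq_norm_tsum_row_le (h : SchurBound M C) (hx : Memℓp x 2) (p : κ) :
    ‖∑' q, M p q * x q‖ ^ 2 ≤ (∑' q, ‖M p q‖ * ‖x q‖) ^ 2 := by
  have hsummable : Summable fun q => ‖M p q * x q‖ := by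
    simpa only [norm_mul] using summable_norm_mul_norm (h.memℓp_row p) hx
  refine pow_le_pow_left₀ (norm_nonneg _) ?_ 2
  simpa only [norm_mul] using norm_tsum_le_tsum_norm hsummable

theorem memℓp_tsum_row (h : SchurBound M C) (hx : Memℓp x 2) :
    Memℓp (fun p => ∑' q, M p q * x q) 2 :=
  memℓp_two_iff.2 (.of_nonneg_of_le (fun _ => sq_nonneg _) (h.sq_norm_tsum_row_le hx)
    (h.summable_sq_tsum_row hx))

theorem exists_continuousLinearMap (h : SchurBound M C) :
    ∃ B : lp (fun _ : κ => ℂ) 2 →L[ℂ] lp (fun _ : κ => ℂ) 2,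
      ∀ x p, HasSum (fun q => M p q * x q) (B x p) := by
  have hsum : ∀ (x : lp (fun _ : κ => ℂ) 2) p, Summable fun q => M p q * x q :=
    fun x p => summable_mul_of_memℓp_two (h.memℓp_row p) x.2
  let L : lp (fun _ : κ => ℂ) 2 →ₗ[ℂ] lp (fun _ : κ => ℂ) 2 :=
    { toFun := fun x => ⟨fun p => ∑' q, M p q * x q, h.memℓp_tsum_row x.2⟩
      map_add' := fun x y => by
        ext p
        simp only [lp.coeFn_add, Pi.add_apply, mul_add]
        exact (hsum x p).tsum_add (hsum y p)
      map_smul' := fun c x => by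
        ext p
        simp only [lp.coeFn_smul, Pi.smul_apply, smul_eq_mul, RingHom.id_apply, mul_left_comm,
          tsum_mul_left] }
  refine ⟨L.mkContinuous C fun x => ?_, fun x p => (hsum x p).hasSum⟩
  refine le_of_sq_le_sq ?_ (mul_nonneg h.bound_nonneg (norm_nonneg x))
  rw [mul_pow, lp_two_norm_sq, lp_two_norm_sq]
  exact ((memℓp_two_iff.1 (L x).2).tsum_le_tsum (h.sq_norm_tsum_row_le x.2)
    (h.summable_sq_tsum_row x.2)).trans (h.tsum_sq_tsum_row_le x.2)

end SchurBound

/-- The rows of the infinite matrix `M` are bounded in `ℓ²`: this is what remains of the Schur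
bound when the symbol of a Toeplitz matrix is only square integrable. -/
def HasBoundedRows (M : Matrix κ κ ℂ) : Prop :=
  ∃ D, ∀ p, Memℓp (M p) 2 ∧ ∑' q, ‖M p q‖ ^ 2 ≤ D

/-- The product of the infinite matrices `M` and `N` converges entrywise to `R`. -/
def HasMatrixProduct (M N R : Matrix κ κ ℂ) : Prop :=
  ∀ p r, HasSum (fun q => M p q * N q r) (R p r)

variable {a x : κ → ℂ} {B : Matrix κ κ ℂ} {C : ℝ}

theorem summable_mul_mul_of_schurBound (hB : SchurBound B C) (ha : Memℓp a 2) (hx : Memℓp x 2) :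
    Summable fun z : κ × κ => a z.1 * B z.1 z.2 * x z.2 := by
  refine .of_norm ((summable_prod_of_nonneg fun z => norm_nonneg _).2 ?_)
  simp only [norm_mul, mul_assoc, tsum_mul_left]
  refine ⟨fun q => (summable_norm_mul_norm (hB.memℓp_row q) hx).mul_left _, ?_⟩
  have hBx : Memℓp (fun q => ((∑' r, ‖B q r‖ * ‖x r‖ : ℝ) : ℂ)) 2 := memℓp_two_iff.2 <| by
    simpa only [Complex.norm_real, Real.norm_eq_abs, sq_abs] using hB.summable_sq_tsum_row hx
  refine (summable_norm_mul_norm ha hBx).congr fun q => ?_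
  rw [Complex.norm_of_nonneg (tsum_nonneg fun r => by positivity)]

theorem summable_mul_mul_of_hasBoundedRows (hB : HasBoundedRows B) (ha : Summable fun q => ‖a q‖)
    (hx : Memℓp x 2) : Summable fun z : κ × κ => a z.1 * B z.1 z.2 * x z.2 := by
  obtain ⟨D, hD⟩ := hB
  refine .of_norm ((summable_prod_of_nonneg fun z => norm_nonneg _).2 ?_)
  simp only [norm_mul, mul_assoc, tsum_mul_left]
  have hrow : ∀ q, Summable fun r => ‖B q r‖ * ‖x r‖ :=
    fun q => summable_norm_mul_norm (hD q).1 hx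
  refine ⟨fun q => (hrow q).mul_left _, ?_⟩
  refine .of_nonneg_of_le (fun q => mul_nonneg (norm_nonneg _) (tsum_nonneg fun r => by positivity))
    (fun q => mul_le_mul_of_nonneg_left ?_ (norm_nonneg _))
    (ha.mul_right ((D + ∑' r, ‖x r‖ ^ 2) / 2))
  have hBq := memℓp_two_iff.1 (hD q).1
  rw [memℓp_two_iff] at hx
  calc ∑' r, ‖B q r‖ * ‖x r‖ ≤ ∑' r, (‖B q r‖ ^ 2 + ‖x r‖ ^ 2) / 2 :=
        (hrow q).tsum_le_tsum (fun r => norm_mul_norm_le_half _ _) ((hBq.add hx).div_const 2)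
    _ = (∑' r, ‖B q r‖ ^ 2 + ∑' r, ‖x r‖ ^ 2) / 2 := by rw [tsum_div_const, hBq.tsum_add hx]
    _ ≤ (D + ∑' r, ‖x r‖ ^ 2) / 2 := by linarith [(hD q).2]

theorem exists_hasSum_hasSum {y c : κ → ℂ}
    (h : Summable fun z : κ × κ => a z.1 * B z.1 z.2 * x z.2)
    (hy : ∀ q, HasSum (fun r => B q r * x r) (y q))
    (hc : ∀ r, HasSum (fun q => a q * B q r) (c r)) :
    ∃ S, HasSum (fun q => a q * y q) S ∧ HasSum (fun r => c r * x r) S := by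
  refine ⟨_, h.hasSum.prod_fiberwise fun q => ?_,
    ((Equiv.prodComm κ κ).hasSum_iff.2 h.hasSum).prod_fiberwise fun r => ?_⟩
  · simpa only [mul_assoc] using (hy q).mul_left (a q)
  · exact (hc r).mul_right (x r)

/-- The commutator `D M - M D` of the infinite matrix `M` with the diagonal matrix `D` of `d`,
defined entrywise since `D` is in general unbounded. For `d (i, k) = jωk` and a Toeplitz matrix `M`
it is the Toeplitz matrix of the derivative of the symbol of `M`. -/
def diagonalCommutator (d : κ → ℂ) (M : Matrix κ κ ℂ) : Matrix κ κ ℂ :=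
  Matrix.of fun p q => d p * M p q - M p q * d q

theorem diagonalCommutator_apply (d : κ → ℂ) (M : Matrix κ κ ℂ) (p q : κ) :
    diagonalCommutator d M p q = d p * M p q - M p q * d q :=
  rfl

theorem summable_mul_mul_sub {d l : κ → ℂ} {V W : Matrix κ κ ℂ} {CV CW : ℝ}
    (hV : SchurBound V CV) (hV' : HasBoundedRows (diagonalCommutator d V))
    (hW : SchurBound W CW) (hW' : HasBoundedRows (diagonalCommutator d W))
    (hx : Memℓp x 2)
    (hl : Memℓp l 2) (p : κ) :
    Summable fun z : κ × κ => V p z.1 * W z.1 z.2 * (l z.2 - d z.2 * x z.2) := by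
  obtain ⟨_, hV'⟩ := hV'
  have hVd : Memℓp (fun q => V p q * d q) 2 := by
    convert ((hV.memℓp_row p).const_smul (d p)).sub (hV' p).1 using 1
    funext q
    simp [diagonalCommutator_apply]
  refine (((summable_mul_mul_of_schurBound hW (hV.memℓp_row p) hl).sub
    (summable_mul_mul_of_schurBound hW hVd hx)).add
    (summable_mul_mul_of_hasBoundedRows hW' (hV.summable_row p) hx)).congr fun z => ?_
  rw [diagonalCommutator_apply]
  ring

variable [DecidableEq κ]

theorem hasSum_one_mul (x : κ → ℂ) (p : κ) :
    HasSum (fun r => (1 : Matrix κ κ ℂ) p r * x r) (x p) := by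
  simpa using hasSum_single (f := fun r => (1 : Matrix κ κ ℂ) p r * x r) p fun r hr => by
    simp [Matrix.one_apply_ne' hr]

theorem hasSum_diagonal_mul (d x : κ → ℂ) (p : κ) :
    HasSum (fun q => Matrix.diagonal d p q * x q) (d p * x p) := by
  simpa using hasSum_single (f := fun q => Matrix.diagonal d p q * x q) p fun q hq => by
    simp [Matrix.diagonal_apply_ne' _ hq]

theorem exists_continuousLinearEquiv {V W : Matrix κ κ ℂ} {CV CW : ℝ} (hV : SchurBound V CV)
    (hW : SchurBound W CW) (hVW : HasMatrixProduct V W 1) (hWV : HasMatrixProduct W V 1) :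
    ∃ 𝒲 : lp (fun _ : κ => ℂ) 2 ≃L[ℂ] lp (fun _ : κ => ℂ) 2,
      (∀ x p, HasSum (fun q => W p q * x q) (𝒲 x p)) ∧
        ∀ x p, HasSum (fun q => V p q * x q) (𝒲.symm x p) := by
  have hinverse : ∀ {M N : Matrix κ κ ℂ} {CM CN : ℝ}, SchurBound M CM → SchurBound N CN →
      HasMatrixProduct M N 1 → ∀ {F G : lp (fun _ : κ => ℂ) 2 →L[ℂ] lp (fun _ : κ => ℂ) 2},
      (∀ x p, HasSum (fun q => M p q * x q) (F x p)) →
      (∀ x p, HasSum (fun q => N p q * x q) (G x p)) → ∀ x, F (G x) = x := by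
    intro M N _ _ hM hN hMN F G hF hG x
    ext p
    obtain ⟨S, hFG, hx⟩ := exists_hasSum_hasSum
      (summable_mul_mul_of_schurBound hN (hM.memℓp_row p) x.2) (hG x) (hMN p)
    rw [(hF (G x) p).unique hFG, hx.unique (hasSum_one_mul x p)]
  obtain ⟨F, hF⟩ := hW.exists_continuousLinearMap
  obtain ⟨G, hG⟩ := hV.exists_continuousLinearMap
  exact ⟨.equivOfInverse F G (hinverse hV hW hVW hG hF) (hinverse hW hV hWV hF hG), hF, hG⟩

section Commutator

variable {d : κ → ℂ} {A V W L N : Matrix κ κ ℂ} {CV CW CL : ℝ} {y l : κ → ℂ}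

/-- Writing `D` for the diagonal matrix of `d`: since `A W = (D W - W D) + W L`, the row sums of
`(A - D) W x` and of `W (L - D) x` agree for every `x` in `ℓ²`. -/
theorem exists_hasSum_intertwining (hA : HasBoundedRows A) (hW : SchurBound W CW)
    (hW' : HasBoundedRows (diagonalCommutator d W)) (hL : SchurBound L CL)
    (hWL : HasMatrixProduct W L N)
    (hAW : HasMatrixProduct A W (diagonalCommutator d W + N)) (hx : Memℓp x 2)
    (hy : ∀ p, HasSum (fun q => W p q * x q) (y p))
    (hl : ∀ p, HasSum (fun q => L p q * x q) (l p)) (p : κ) :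
    ∃ S, HasSum (fun q => (A - Matrix.diagonal d) p q * y q) S ∧
      HasSum (fun r => W p r * (l r - d r * x r)) S := by
  obtain ⟨_, hA⟩ := hA
  obtain ⟨_, hW'⟩ := hW'
  obtain ⟨S, hAy, hS⟩ := exists_hasSum_hasSum
    (summable_mul_mul_of_schurBound hW (hA p).1 hx) hy (hAW p)
  obtain ⟨R, hWl, hR⟩ := exists_hasSum_hasSum
    (summable_mul_mul_of_schurBound hL (hW.memℓp_row p) hx) hl (hWL p)
  obtain ⟨Q, hQ⟩ := summable_mul_of_memℓp_two (hW' p).1 hx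
  have hSQR : S = Q + R := hS.unique (by
    simpa only [Matrix.add_apply, add_mul] using hQ.add hR)
  refine ⟨S - d p * y p, ?_, ?_⟩
  · simpa only [Matrix.sub_apply, sub_mul] using hAy.sub (hasSum_diagonal_mul d y p)
  · rw [show S - d p * y p = R - (d p * y p - Q) by rw [hSQR]; ring]
    refine (hWl.sub (((hy p).mul_left (d p)).sub hQ)).congr_fun fun r => ?_
    rw [diagonalCommutator_apply]
    ring

theorem eq_of_hasSum_intertwining (hV : SchurBound V CV)
    (hV' : HasBoundedRows (diagonalCommutator d V)) (hW : SchurBound W CW)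
    (hW' : HasBoundedRows (diagonalCommutator d W)) (hVW : HasMatrixProduct V W 1)
    (hx : Memℓp x 2) (hl : Memℓp l 2)
    (hy : ∀ q, HasSum (fun r => W q r * (l r - d r * x r)) (y q)) {p : κ} {b : ℂ}
    (hb : HasSum (fun q => V p q * y q) b) : l p - d p * x p = b := by
  obtain ⟨S, hVy, hS⟩ := exists_hasSum_hasSum (x := fun r => l r - d r * x r)
    (summable_mul_mul_sub hV hV' hW hW' hx hl p) hy (hVW p)
  rw [← hS.unique (hasSum_one_mul _ p), hVy.unique hb]

end Commutator

end Schur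

section MatrixOperator

variable {n : ℕ}

theorem mem_graph_matrixOperator_iff {M : Matrix (Fin n × ℤ) (Fin n × ℤ) ℂ} {x y : EllTwo n} :
    (x, y) ∈ (matrixOperator M).graph ↔ ∀ p, HasSum (fun q => M p q * x q) (y p) := by
  rw [LinearPMap.mem_graph_iff]
  constructor
  · rintro ⟨x, rfl, rfl⟩
    exact matrixOperator_hasSum M x
  · refine fun h => ⟨⟨x, y, h⟩, rfl, ?_⟩
    ext p
    exact (matrixOperator_hasSum M ⟨x, y, h⟩ p).unique (h p)

theorem mem_graph_conjugate_iff {B : EllTwo n ≃L[ℂ] EllTwo n} {L : EllTwo n →ₗ.[ℂ] EllTwo n}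
    {x y : EllTwo n} : (x, y) ∈ (conjugate B L).graph ↔ (B x, B y) ∈ L.graph := by
  simp only [LinearPMap.mem_graph_iff]
  constructor
  · rintro ⟨x, rfl, rfl⟩
    exact ⟨⟨B x, x.2⟩, rfl, (B.apply_symm_apply _).symm⟩
  · rintro ⟨⟨_, hx⟩, rfl, hy⟩
    exact ⟨⟨x, hx⟩, rfl, B.symm_apply_eq.2 hy⟩

/-- `A W = (D W - W D) + W L` says that `W` conjugates `A - D` to `L - D`. -/
theorem conjugate_matrixOperator_sub_diagonal {A V W L N : Matrix (Fin n × ℤ) (Fin n × ℤ) ℂ}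
    {d : Fin n × ℤ → ℂ} {CV CW CL : ℝ} (hA : HasBoundedRows A) (hV : SchurBound V CV)
    (hV' : HasBoundedRows (diagonalCommutator d V)) (hW : SchurBound W CW)
    (hW' : HasBoundedRows (diagonalCommutator d W)) (hL : SchurBound L CL)
    (hVW : HasMatrixProduct V W 1) (hWL : HasMatrixProduct W L N)
    (hAW : HasMatrixProduct A W (diagonalCommutator d W + N)) {𝒲 : EllTwo n ≃L[ℂ] EllTwo n}
    (h𝒲 : IsMatrixOf W 𝒲) (h𝒱 : IsMatrixOf V 𝒲.symm) :
    conjugate 𝒲 (matrixOperator (A - Matrix.diagonal d)) =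
      matrixOperator (L - Matrix.diagonal d) := by
  obtain ⟨ℒ, hℒ⟩ := hL.exists_continuousLinearMap
  have hLD : ∀ (x : EllTwo n) p, HasSum (fun q => (L - Matrix.diagonal d) p q * x q)
      (ℒ x p - d p * x p) := fun x p => by
    simpa only [Matrix.sub_apply, sub_mul] using (hℒ x p).sub (hasSum_diagonal_mul d x p)
  refine LinearPMap.eq_of_eq_graph (Submodule.ext fun ⟨x, y⟩ => ?_)
  rw [mem_graph_conjugate_iff, mem_graph_matrixOperator_iff, mem_graph_matrixOperator_iff]
  have hforward := exists_hasSum_intertwining hA hW hW' hL hWL hAW x.2 (h𝒲 x) (hℒ x)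
  constructor
  · intro hAD p
    have hy : ∀ q, HasSum (fun r => W q r * (ℒ x r - d r * x r)) (𝒲 y q) := fun q => by
      obtain ⟨S, hS, hWS⟩ := hforward q
      rwa [(hAD q).unique hS]
    have hp := eq_of_hasSum_intertwining hV hV' hW hW' hVW x.2 (ℒ x).2 hy (h𝒱 (𝒲 y) p)
    rw [ContinuousLinearEquiv.coe_coe, 𝒲.symm_apply_apply] at hp
    exact hp ▸ hLD x p
  · intro hy p
    obtain ⟨S, hS, hWS⟩ := hforward p
    simp only [fun r => (hLD x r).unique (hy r)] at hWS
    have hSy : 𝒲 y p = S := (h𝒲 y p).unique hWS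
    rwa [hSy]

end MatrixOperator

/-! ### Harmonic operators -/

theorem hasSum_prod_of_fintype {ι κ E : Type*} [Fintype ι] [AddCommMonoid E] [TopologicalSpace E]
    [ContinuousAdd E] {f : ι × κ → E} {s : ι → E} (h : ∀ i, HasSum (fun k => f (i, k)) (s i)) :
    HasSum f (∑ i, s i) := by
  classical
  have hblock : ∀ i, HasSum (fun z : ι × κ => if z.1 = i then f z else 0) (s i) := by
    intro i
    rw [← Function.Injective.hasSum_iff (Prod.mk_right_injective i)]
    · simpa [Function.comp_def] using h i
    · rintro ⟨j, k⟩ hz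
      rw [if_neg]
      rintro rfl
      exact hz ⟨k, rfl⟩
  simpa using hasSum_sum fun i (_ : i ∈ Finset.univ) => hblock i

theorem memLp_mul_continuous {K : Set ℝ} (hK : IsCompact K) {p : ENNReal} {a f : ℝ → ℂ}
    (ha : MemLp a p (volume.restrict K)) (hf : Continuous f) :
    MemLp (fun t => a t * f t) p (volume.restrict K) := by
  obtain ⟨C, hC⟩ := hK.exists_bound_of_continuousOn hf.continuousOn
  have hf_top : MemLp f ⊤ (volume.restrict K) :=
    memLp_top_of_bound hf.aestronglyMeasurable C
      ((ae_restrict_iff' hK.measurableSet).2 (.of_forall hC))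
  exact hf_top.mul ha

section MemLp

variable {l m o : Type*} [Fintype m] {K : Set ℝ} (hK : IsCompact K) {p : ENNReal}
include hK

theorem memLp_matrix_mul_continuous {F : ℝ → Matrix l m ℂ} {G : ℝ → Matrix m o ℂ}
    (hF : ∀ i j, MemLp (fun t => F t i j) p (volume.restrict K))
    (hG : ∀ i j, Continuous fun t => G t i j) (i : l) (j : o) :
    MemLp (fun t => (F t * G t) i j) p (volume.restrict K) := by
  simp only [Matrix.mul_apply]
  exact memLp_finsetSum _ fun k _ => memLp_mul_continuous hK (hF i k) (hG k j)

theorem memLp_continuous_matrix_mul {F : ℝ → Matrix l m ℂ} {G : ℝ → Matrix m o ℂ}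
    (hF : ∀ i j, Continuous fun t => F t i j)
    (hG : ∀ i j, MemLp (fun t => G t i j) p (volume.restrict K)) (i : l) (j : o) :
    MemLp (fun t => (F t * G t) i j) p (volume.restrict K) := by
  simp only [Matrix.mul_apply, mul_comm (F _ _ _)]
  exact memLp_finsetSum _ fun k _ => memLp_mul_continuous hK (hG k j) (hF i k)

end MemLp

theorem intervalIntegrable_of_memLp {T : ℝ} (hT : 0 ≤ T) {a : ℝ → ℂ} {p : ENNReal} (hp : 1 ≤ p)
    (ha : MemLp a p (volume.restrict (Set.Icc 0 T))) : IntervalIntegrable a volume 0 T :=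
  (intervalIntegrable_iff_integrableOn_Icc_of_le hT).2 (ha.integrable hp)

theorem locallyIntegrable_of_periodic_memLp {T : ℝ} (hT : 0 < T) {a : ℝ → ℂ} {p : ENNReal}
    (hp : 1 ≤ p) (hper : Function.Periodic a T)
    (ha : MemLp a p (volume.restrict (Set.Icc 0 T))) : LocallyIntegrable a :=
  locallyIntegrable_of_intervalIntegrable <| hper.intervalIntegrable (t := 0) hT.ne' <| by
    simpa only [zero_add] using intervalIntegrable_of_memLp hT.le hp ha

theorem periodic_apply_apply {l m : Type*} {T : ℝ} {F : ℝ → Matrix l m ℂ}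
    (hF : Function.Periodic F T) (i : l) (j : m) : Function.Periodic (fun t => F t i j) T :=
  fun t => congrFun₂ (hF t) i j

section BlockToeplitz

variable {n : ℕ} {T : ℝ} {F F' G : ℝ → Matrix (Fin n) (Fin n) ℂ}

theorem hasSum_comp_blockToeplitz_row {φ : ℂ → ℝ}
    (hF : ∀ i j, Summable fun k => φ (phasor T (fun t => F t i j) k)) (p : Fin n × ℤ) :
    HasSum (fun q => φ (blockToeplitz T F p q))
      (∑ j, ∑' k, φ (phasor T (fun t => F t p.1 j) k)) :=
  hasSum_prod_of_fintype fun j => (Equiv.subLeft p.2).hasSum_iff.2 (hF p.1 j).hasSum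

theorem hasSum_comp_blockToeplitz_col {φ : ℂ → ℝ}
    (hF : ∀ i j, Summable fun k => φ (phasor T (fun t => F t i j) k)) (q : Fin n × ℤ) :
    HasSum (fun p => φ (blockToeplitz T F p q))
      (∑ i, ∑' k, φ (phasor T (fun t => F t i q.1) k)) :=
  hasSum_prod_of_fintype fun i => (Equiv.subRight q.2).hasSum_iff.2 (hF i q.1).hasSum

theorem schurBound_blockToeplitz (hF : ∀ i j, Summable fun k => ‖phasor T (fun t => F t i j) k‖) :
    SchurBound (blockToeplitz T F) (∑ i, ∑ j, ∑' k, ‖phasor T (fun t => F t i j) k‖) where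
  bound_nonneg := by positivity
  summable_row p := (hasSum_comp_blockToeplitz_row hF p).summable
  tsum_row_le p := (hasSum_comp_blockToeplitz_row hF p).tsum_eq.trans_le <|
    Finset.single_le_sum (f := fun i => ∑ j, ∑' k, ‖phasor T (fun t => F t i j) k‖)
      (fun _ _ => by positivity) (Finset.mem_univ p.1)
  summable_col q := (hasSum_comp_blockToeplitz_col hF q).summable
  tsum_col_le q := (hasSum_comp_blockToeplitz_col hF q).tsum_eq.trans_le <|
    Finset.sum_le_sum fun i _ => Finset.single_le_sum
      (f := fun j => ∑' k, ‖phasor T (fun t => F t i j) k‖)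
      (fun _ _ => by positivity) (Finset.mem_univ q.1)

theorem hasBoundedRows_blockToeplitz (hT : 0 < T)
    (hF : ∀ i j, MemLp (fun t => F t i j) 2 (volume.restrict (Set.Icc 0 T))) :
    HasBoundedRows (blockToeplitz T F) := by
  have hrow := hasSum_comp_blockToeplitz_row (φ := fun z => ‖z‖ ^ 2)
    fun i j => summable_sq_phasor hT (hF i j)
  refine ⟨∑ i, ∑ j, ∑' k, ‖phasor T (fun t => F t i j) k‖ ^ 2,
    fun p => ⟨memℓp_two_iff.2 (hrow p).summable, (hrow p).tsum_eq.trans_le ?_⟩⟩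
  exact Finset.single_le_sum (f := fun i => ∑ j, ∑' k, ‖phasor T (fun t => F t i j) k‖ ^ 2)
    (fun _ _ => by positivity) (Finset.mem_univ p.1)

theorem blockToeplitz_add (hF : ∀ i j, IntervalIntegrable (fun t => F t i j) volume 0 T)
    (hG : ∀ i j, IntervalIntegrable (fun t => G t i j) volume 0 T) :
    blockToeplitz T (fun t => F t + G t) = blockToeplitz T F + blockToeplitz T G := by
  ext p q
  exact phasor_add (hF p.1 q.1) (hG p.1 q.1) _

theorem blockToeplitz_const (hT : T ≠ 0) (Λ : Matrix (Fin n) (Fin n) ℂ) :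
    blockToeplitz T (fun _ => Λ) = Λ ⊗ₖ (1 : Matrix ℤ ℤ ℂ) := by
  ext p q
  simp [blockToeplitz, phasor_const hT, Matrix.one_apply, sub_eq_zero]

/-- The diagonal entries `jωk` of the matrix `𝒩`. -/
noncomputable def harmonicFrequency (n : ℕ) (T : ℝ) (p : Fin n × ℤ) : ℂ :=
  angularFrequency T * p.2

theorem harmonicN_eq_diagonal : harmonicN n T = Matrix.diagonal (harmonicFrequency n T) := by
  rw [harmonicN, ← Matrix.diagonal_one, Matrix.diagonal_kronecker_diagonal]
  simp only [one_mul]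
  rfl

theorem blockToeplitz_deriv (hF : IsMatPrimitive F F') (hper : F T = F 0) :
    blockToeplitz T F' = diagonalCommutator (harmonicFrequency n T) (blockToeplitz T F) := by
  ext p q
  have hderiv := (hF p.1 q.1).phasor_deriv (congrFun₂ hper p.1 q.1) (p.2 - q.2)
  rw [diagonalCommutator_apply, harmonicFrequency, harmonicFrequency]
  refine hderiv.trans ?_
  push_cast
  simp only [blockToeplitz, Matrix.of_apply]
  ring

/-- The phasors `c k` of `F` are absolutely summable because those of `F'`, which are `jωk c k`,
are square summable. -/
theorem IsMatPrimitive.summable_norm_phasor (hT : 0 < T) (hF : IsMatPrimitive F F')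
    (hF' : ∀ i j, MemLp (fun t => F' t i j) 2 (volume.restrict (Set.Icc 0 T)))
    (hper : F T = F 0) (i j : Fin n) : Summable fun k => ‖phasor T (fun t => F t i j) k‖ :=
  summable_norm_of_summable_sq_mul
    ((hF i j).summable_sq_mul_phasor hT (hF' i j) (congrFun₂ hper i j))

theorem hasMatrixProduct_blockToeplitz (hT : 0 < T)
    (hF : ∀ i j, IntervalIntegrable (fun t => F t i j) volume 0 T)
    (hG : ∀ i j, Continuous fun t => G t i j) (hper : Function.Periodic G T)
    (hs : ∀ i j, Summable fun k => ‖phasor T (fun t => G t i j) k‖) :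
    HasMatrixProduct (blockToeplitz T F) (blockToeplitz T G)
      (blockToeplitz T fun t => F t * G t) := by
  intro p r
  simp only [blockToeplitz, Matrix.of_apply, Matrix.mul_apply]
  rw [phasor_sum _ fun j _ => (hF p.1 j).mul_continuousOn (hG j r.1).continuousOn]
  refine hasSum_prod_of_fintype fun j => ?_
  have hconv := (Equiv.subRight r.2).hasSum_iff.2 (hasSum_phasor_mul hT (hF p.1 j) (hG j r.1)
    (periodic_apply_apply hper j r.1) (hs j r.1) (p.2 - r.2))
  simpa only [Function.comp_def, Equiv.subRight_apply, sub_sub_sub_cancel_right] using hconv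

theorem hasMatrixProduct_blockToeplitz_one (hT : 0 < T)
    (hF : ∀ i j, Continuous fun t => F t i j) (hG : ∀ i j, Continuous fun t => G t i j)
    (hper : Function.Periodic G T)
    (hs : ∀ i j, Summable fun k => ‖phasor T (fun t => G t i j) k‖) (hFG : ∀ t, F t * G t = 1) :
    HasMatrixProduct (blockToeplitz T F) (blockToeplitz T G) 1 := by
  have hprod := hasMatrixProduct_blockToeplitz hT (fun i j => (hF i j).intervalIntegrable 0 T)
    hG hper hs
  rwa [funext hFG, blockToeplitz_const hT.ne', Matrix.one_kronecker_one] at hprod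

theorem IsMatPrimitive.hasBoundedRows_diagonalCommutator (hT : 0 < T) (hF : IsMatPrimitive F F')
    (hF' : ∀ i j, MemLp (fun t => F' t i j) 2 (volume.restrict (Set.Icc 0 T)))
    (hper : F T = F 0) :
    HasBoundedRows (diagonalCommutator (harmonicFrequency n T) (blockToeplitz T F)) :=
  blockToeplitz_deriv hF hper ▸ hasBoundedRows_blockToeplitz hT hF'

section FloquetFactor

variable {A W : ℝ → Matrix (Fin n) (Fin n) ℂ} {Λ : Matrix (Fin n) (Fin n) ℂ}

theorem memLp_mul_sub_mul_const
    (hA : ∀ i j, MemLp (fun t => A t i j) 2 (volume.restrict (Set.Icc 0 T)))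
    (hW : ∀ i j, Continuous fun t => W t i j) (i j : Fin n) :
    MemLp (fun t => (A t * W t - W t * Λ) i j) 2 (volume.restrict (Set.Icc 0 T)) :=
  (memLp_matrix_mul_continuous isCompact_Icc hA hW i j).sub
    (memLp_continuous_matrix_mul isCompact_Icc (G := fun _ => Λ) hW (fun _ _ => memLp_const _) i j)

theorem memLp_neg_mul_add_const_mul
    (hA : ∀ i j, MemLp (fun t => A t i j) 2 (volume.restrict (Set.Icc 0 T)))
    (hW : ∀ i j, Continuous fun t => W t i j) (i j : Fin n) :
    MemLp (fun t => (-(W t * A t) + Λ * W t) i j) 2 (volume.restrict (Set.Icc 0 T)) :=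
  (memLp_continuous_matrix_mul isCompact_Icc hW hA i j).neg.add
    (memLp_matrix_mul_continuous isCompact_Icc (F := fun _ => Λ) (fun _ _ => memLp_const _) hW i j)

/-- The Toeplitz form of `Ẇ = A W - W Λ`. -/
theorem hasMatrixProduct_blockToeplitz_of_isMatPrimitive (hT : 0 < T)
    (hA : ∀ i j, IntervalIntegrable (fun t => A t i j) volume 0 T)
    (hW : IsMatPrimitive W fun t => A t * W t - W t * Λ) (hper : Function.Periodic W T)
    (hs : ∀ i j, Summable fun k => ‖phasor T (fun t => W t i j) k‖) :
    HasMatrixProduct (blockToeplitz T A) (blockToeplitz T W)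
      (diagonalCommutator (harmonicFrequency n T) (blockToeplitz T W) +
        blockToeplitz T fun t => W t * Λ) := by
  have hWΛ := hW.mul (IsMatPrimitive.const Λ)
  rw [← blockToeplitz_deriv hW hper.eq, ← blockToeplitz_add
    (fun i j => intervalIntegrable_of_locallyIntegrable (hW i j).locallyIntegrable 0 T)
    fun i j => (hWΛ i j).continuous.intervalIntegrable 0 T]
  simpa only [sub_add_cancel] using
    hasMatrixProduct_blockToeplitz hT hA (fun i j => (hW i j).continuous) hper hs

theorem exists_harmonic_similarity (hT : 0 < T)
    (hA : ∀ i j, MemLp (fun t => A t i j) 2 (volume.restrict (Set.Icc 0 T)))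
    (hW : IsMatPrimitive W fun t => A t * W t - W t * Λ)
    (hV : IsMatPrimitive (fun t => (W t)⁻¹) fun t => -((W t)⁻¹ * A t) + Λ * (W t)⁻¹)
    (hdet : ∀ t, IsUnit (W t).det) (hWper : Function.Periodic W T) :
    ∃ 𝒲 : EllTwo n ≃L[ℂ] EllTwo n,
      IsMatrixOf (blockToeplitz T W) (𝒲 : EllTwo n →L[ℂ] EllTwo n) ∧
      conjugate 𝒲 (matrixOperator (blockToeplitz T A - harmonicN n T)) =
        matrixOperator (Λ ⊗ₖ (1 : Matrix ℤ ℤ ℂ) - harmonicN n T) := by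
  have hVper : Function.Periodic (fun t => (W t)⁻¹) T := hWper.comp _
  have hWc : ∀ i j, Continuous fun t => W t i j := fun i j => (hW i j).continuous
  have hVc : ∀ i j, Continuous fun t => (W t)⁻¹ i j := fun i j => (hV i j).continuous
  have hW' := memLp_mul_sub_mul_const (Λ := Λ) hA hWc
  have hV' := memLp_neg_mul_add_const_mul (Λ := Λ) hA hVc
  have hWs := hW.summable_norm_phasor hT hW' hWper.eq
  have hVs := hV.summable_norm_phasor hT hV' hVper.eq
  have hΛs := (IsMatPrimitive.const Λ).summable_norm_phasor hT (fun _ _ => memLp_const 0) rfl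
  have hVW := hasMatrixProduct_blockToeplitz_one hT hVc hWc hWper hWs
    fun t => Matrix.nonsing_inv_mul _ (hdet t)
  have hWV := hasMatrixProduct_blockToeplitz_one hT hWc hVc hVper hVs
    fun t => Matrix.mul_nonsing_inv _ (hdet t)
  have hWΛ := hasMatrixProduct_blockToeplitz (G := fun _ => Λ) hT
    (fun i j => (hWc i j).intervalIntegrable 0 T) (fun _ _ => continuous_const) (fun _ => rfl) hΛs
  have hAW := hasMatrixProduct_blockToeplitz_of_isMatPrimitive hT
    (fun i j => intervalIntegrable_of_memLp hT.le one_le_two (hA i j)) hW hWper hWs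
  obtain ⟨𝒲, h𝒲, h𝒱⟩ := exists_continuousLinearEquiv (schurBound_blockToeplitz hVs)
    (schurBound_blockToeplitz hWs) hVW hWV
  refine ⟨𝒲, h𝒲, ?_⟩
  rw [harmonicN_eq_diagonal, ← blockToeplitz_const hT.ne']
  exact conjugate_matrixOperator_sub_diagonal (hasBoundedRows_blockToeplitz hT hA)
    (schurBound_blockToeplitz hVs) (hV.hasBoundedRows_diagonalCommutator hT hV' hVper.eq)
    (schurBound_blockToeplitz hWs) (hW.hasBoundedRows_diagonalCommutator hT hW' hWper.eq)
    (schurBound_blockToeplitz hΛs) hVW hWΛ hAW h𝒲 h𝒱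

end FloquetFactor

end BlockToeplitz

end Floquet

theorem mainTheorem1 (n : ℕ) (T : ℝ) (hT : 0 < T) (A : ℝ → Matrix (Fin n) (Fin n) ℂ)
    (hper : Function.Periodic A T)
    (hL2 : ∀ i j, MemLp (fun t => A t i j) 2 (volume.restrict (Set.Icc 0 T))) :
    (∃! Φ : ℝ → Matrix (Fin n) (Fin n) ℂ, Floquet.IsTransitionMatrix A Φ) ∧
    ∀ Φ : ℝ → Matrix (Fin n) (Fin n) ℂ, Floquet.IsTransitionMatrix A Φ →
      (∃ (μ : Fin n → ℂ) (s : Fin n → Bool) (P : Matrix (Fin n) (Fin n) ℂ),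
        Floquet.IsJordanBasis (Φ T) μ s P) ∧
      ∀ (μ : Fin n → ℂ) (s : Fin n → Bool) (P : Matrix (Fin n) (Fin n) ℂ),
        Floquet.IsJordanBasis (Φ T) μ s P →
        -- no eigenvalue vanishes, so the exponents are logarithms
        (∀ i, μ i ≠ 0) ∧
        -- the Jordan basis `P` can be normalized; the correction of a generalized eigenvector
        -- involves only earlier ones of its block, and the first two of a block are kept
        (∃ C : Matrix (Fin n) (Fin n) ℂ,
          (∀ i, C i i = 1) ∧
          (∀ i j, i ≠ j → C i j ≠ 0 → Floquet.SameBlock s i j ∧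
            ∃ k : Fin n, Floquet.SameBlock s k j ∧ (k : ℕ) + 2 ≤ j) ∧
          Floquet.IsNormalizedBasis T (Φ T) μ s (P * C)) ∧
        -- every normalized basis yields a Floquet factorization
        ∀ Ψ : Matrix (Fin n) (Fin n) ℂ, Floquet.IsNormalizedBasis T (Φ T) μ s Ψ →
          (∃! v : Fin n → ℝ → Fin n → ℂ, Floquet.IsFloquetSolution T A μ s Ψ v) ∧
          ∀ v : Fin n → ℝ → Fin n → ℂ, Floquet.IsFloquetSolution T A μ s Ψ v →
          ∀ W : ℝ → Matrix (Fin n) (Fin n) ℂ, (∀ t i j, W t i j = v j t i) →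
          ∀ Λ : Matrix (Fin n) (Fin n) ℂ, Λ = Floquet.floquetMatrix T μ s →
            -- periodicity, invertibility, absolute continuity
            (∀ j, Function.Periodic (v j) T) ∧
            Function.Periodic W T ∧
            (∀ t, IsUnit (W t).det) ∧
            Function.Periodic (fun t => (W t)⁻¹) T ∧
            (∀ i j, Floquet.LocAbsCont (fun t => W t i j)) ∧
            (∀ i j, Floquet.LocAbsCont (fun t => (W t)⁻¹ i j)) ∧
            -- the Floquet factorization `Φ(t,0) = W(t) e^{tΛ} W(0)⁻¹`
            (∀ t : ℝ, Φ t = W t * NormedSpace.exp ((t : ℂ) • Λ) * (W 0)⁻¹) ∧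
            -- the differential equations of `W` and `W⁻¹`
            (∀ᵐ t : ℝ, ∀ i j,
              HasDerivAt (fun τ => W τ i j) ((A t * W t - W t * Λ) i j) t) ∧
            (∀ᵐ t : ℝ, ∀ i j,
              HasDerivAt (fun τ => (W τ)⁻¹ i j) ((-((W t)⁻¹ * A t) + Λ * (W t)⁻¹) i j) t) ∧
            -- the eigenvalue problem on `ℓ²`
            (∃ 𝒲 : Floquet.EllTwo n ≃L[ℂ] Floquet.EllTwo n,
              Floquet.IsMatrixOf (Floquet.blockToeplitz T W)
                (𝒲 : Floquet.EllTwo n →L[ℂ] Floquet.EllTwo n) ∧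
              Floquet.conjugate 𝒲
                  (Floquet.matrixOperator (Floquet.blockToeplitz T A - Floquet.harmonicN n T)) =
                Floquet.matrixOperator
                  (Λ ⊗ₖ (1 : Matrix ℤ ℤ ℂ) - Floquet.harmonicN n T)) ∧
            -- reduction of `ẋ = A(t) x` to `ż = Λ z`
            (∀ x : ℝ → Fin n → ℂ, Floquet.IsSolution A x ↔
              Floquet.IsSolution (fun _ => Λ) (fun t => (W t)⁻¹ *ᵥ x t)) := by
  have hA := fun i j =>
    Floquet.locallyIntegrable_of_periodic_memLp hT one_le_two
      (Floquet.periodic_apply_apply hper i j) (hL2 i j)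
  refine ⟨Floquet.existsUnique_isTransitionMatrix hA, fun Φ hΦ =>
    ⟨Floquet.exists_isJordanBasis (Φ T), fun μ s P hP => ?_⟩⟩
  have hμ := hP.eigenvalue_ne_zero (hΦ.isUnit_det hA T)
  refine ⟨hμ, Floquet.exists_isNormalizedBasis hT.ne' hP hμ, fun Ψ hΨ =>
    ⟨Floquet.existsUnique_isFloquetSolution hA, ?_⟩⟩
  rintro v hv W hWv Λ rfl
  obtain rfl := (Floquet.isFloquetSolution_iff_eq_floquetFactor hA hΦ hWv).1 hv
  have hW := Floquet.isMatPrimitive_floquetFactor Ψ (Floquet.floquetMatrix T μ s) hΦ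
  have hV := Floquet.isMatPrimitive_inv_floquetFactor Ψ (Floquet.floquetMatrix T μ s) hA hΦ
  have hdet := Floquet.isUnit_det_floquetFactor (Floquet.floquetMatrix T μ s) hA hΦ hΨ.1
  have hWper := Floquet.periodic_floquetFactor hA hΦ hper hΨ.2
  refine ⟨fun j t => ?_, hWper, hdet, hWper.comp _, fun i j => (hW i j).1, fun i j => (hV i j).1,
    fun t => ?_, hW.ae_hasDerivAt, hV.ae_hasDerivAt,
    Floquet.exists_harmonic_similarity hT hL2 hW hV hdet hWper,
    Floquet.isSolution_iff_isSolution_inv_mulVec hW hV hdet⟩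
  · funext i
    rw [← hWv, ← hWv, hWper t]
  · rw [Floquet.floquetFactor_mul_exp_smul, Floquet.floquetFactor_zero hΦ,
      Matrix.mul_nonsing_inv_cancel_right _ _ hΨ.1]
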